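/- Conventions. For a lattice $L=A\mathbb Z^d\subset\mathbb R^d$ ($A\in\mathrm{GL}_d(\mathbb R)$) let $\mu(L)$ be its covering radius, $\kappa_d$ the volume of the unit ball and $\Theta(L)=\mu(L)^d\kappa_d/|\det A|$ its covering density; the positive definite form $Q=A^tA$, $Q[x]=x^tQx$, is said to be associated to $L$. A Delone polytope of a positive definite form $Q$ is the convex hull of a non-empty finite set $V\subset\mathbb Z^d$ for which there are $c\in\mathbb R^d$, $r\in\mathbb R$ with $Q[v-c]=r^2$ for $v\in V$ and $Q[v-c]>r^2$ for $v\in\mathbb Z^d\setminus V$; the Delone subdivision $\mathrm{Del}(Q)$ is the set of all Delone polytopes of $Q$. $\mathrm{Del}(R)$ refines $\mathrm{Del}(Q)$ if every member of $\mathrm{Del}(R)$ is contained in a member of $\mathrm{Del}(Q)$. The Delone subdivisions of two lattices have a common refinement if there are forms $Q$, $Q'$ associated to them and a positive definite form $R$ such that $\mathrm{Del}(R)$ refines both $\mathrm{Del}(Q)$ and $\mathrm{Del}(Q')$. Let $\mathsf E_8=\{x\in\mathbb Z^8\cup(\tfrac12+\mathbb Z)^8:\sum x_i\in 2\mathbb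 Z\}$, let $B$ be the matrix whose columns are the basis $2e_1,\ e_2-e_1,\ e_3-e_2,\dots,e_7-e_6,\ \tfrac12(e_1+\dots+e_8)$ of $\mathsf E_8$, and let $Q_{\mathsf E_8}=B^tB$. Let $$\tilde Q=34229189769\,Q_1-17121746137\,Q_2,$$ where $Q_1,Q_2$ are the symmetric $8\times 8$ matrices whose non-zero entries on and above the diagonal are: for $Q_1$, $(1,1)\colon 1$, $(1,8)\colon 2$, $(8,8)\colon 4$, $(2,2)\colon \tfrac47$, $(i,i)\colon\tfrac43$ for $3\le i\le 7$, $(i,i+1)\colon-\tfrac23$ for $2\le i\le 6$; for $Q_2$, $(1,2)\colon 1$, $(1,8)\colon\tfrac72$, $(8,8)\colon 7$, $(i,i)\colon\tfrac43$ for $3\le i\le 7$, $(i,i+1)\colon-\tfrac23$ for $2\le i\le 6$. Theorem. There exists a lattice $L\subset\mathbb R^8$ with covering density $\Theta(L)<3.2013$ whose Delone subdivision has a common refinement with the one of $\mathsf E_8$. More precisely, $L$ can be chosen so that $\tilde Q$ is associated to $L$; the form $Q_{\mathsf E_8}$ is associated to $\mathsf E_8$; and there is a positive definite form $R$ whose Delone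 subdivision consists of simplices only, refines both $\mathrm{Del}(\tilde Q)$ and $\mathrm{Del}(Q_{\mathsf E_8})$, and is invariant under $x\mapsto -x$ and under all maps $B^{-1}PB$, where $P$ runs through the permutation matrices of $\mathbb R^8$ that fix the first coordinate. -/

import Mathlib

open scoped Matrix

noncomputable section

namespace LatticeCovering

/-! ### Lattices, covering radius, covering density -/

/-- Euclidean `d`-space. -/
abbrev Euc (d : ℕ) : Type := EuclideanSpace ℝ (Fin d)

/-- The covering radius of `L`: the least `r > 0` such that the closed balls of radius `r` around
the points of `L` cover the space. -/
def coveringRadius {d : ℕ} (L : Submodule ℤ (Euc d)) : ℝ :=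
  sInf {r : ℝ | 0 < r ∧ ∀ x : Euc d, ∃ v ∈ L, x ∈ Metric.closedBall v r}

/-- The volume of the unit ball of `d`-dimensional Euclidean space. -/
def unitBallVolume (d : ℕ) : ℝ :=
  (MeasureTheory.volume (Metric.closedBall (0 : Euc d) 1)).toReal

/-- The covering density of `L`. -/
def coveringDensity {d : ℕ} (L : Submodule ℤ (Euc d)) : ℝ :=
  coveringRadius L ^ d * unitBallVolume d / ZLattice.covolume L

/-! ### Quadratic forms and Delone subdivisions -/

/-- The value `Q[x] = xᵗ Q x`. -/
def qval {d : ℕ} (Q : Matrix (Fin d) (Fin d) ℝ) (x : Fin d → ℝ) : ℝ :=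
  x ⬝ᵥ (Q *ᵥ x)

/-- An integer vector as a real vector. -/
def intVec {d : ℕ} (v : Fin d → ℤ) : Fin d → ℝ := fun i => (v i : ℝ)

/-- `Q` is associated to `L`: there is a regular matrix `A` with `L = A ℤ^d` and `Q = Aᵗ A`. -/
def IsAssociated {d : ℕ} (Q : Matrix (Fin d) (Fin d) ℝ) (L : Submodule ℤ (Euc d)) : Prop :=
  ∃ A : Matrix (Fin d) (Fin d) ℝ, A.det ≠ 0 ∧
    (L : Set (Euc d)) = Set.range (fun v : Fin d → ℤ => WithLp.toLp 2 (A *ᵥ intVec v)) ∧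
    Q = Aᵀ * A

/-- `P` is a Delone polytope of `Q`: it is the convex hull of a finite nonempty set `V` of integer
vectors which lie on the boundary of an ellipsoid `{x | Q[x - c] ≤ r ^ 2}`, all other integer
vectors lying strictly outside of it. -/
def IsDelonePolytope {d : ℕ} (Q : Matrix (Fin d) (Fin d) ℝ) (P : Set (Fin d → ℝ)) : Prop :=
  ∃ V : Finset (Fin d → ℤ), V.Nonempty ∧
    P = convexHull ℝ (intVec '' (V : Set (Fin d → ℤ))) ∧
    ∃ (c : Fin d → ℝ) (r : ℝ),
      (∀ v ∈ V, qval Q (intVec v - c) = r ^ 2) ∧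
      (∀ v : Fin d → ℤ, v ∉ V → r ^ 2 < qval Q (intVec v - c))

/-- The Delone subdivision of `Q`: the set of all its Delone polytopes (of all dimensions). -/
def deloneSubdivision {d : ℕ} (Q : Matrix (Fin d) (Fin d) ℝ) : Set (Set (Fin d → ℝ)) :=
  {P | IsDelonePolytope Q P}

/-- The family `S` refines the family `T`: every member of `S` is contained in a member of `T`. -/
def IsRefinement {d : ℕ} (S T : Set (Set (Fin d → ℝ))) : Prop :=
  ∀ P ∈ S, ∃ P' ∈ T, P ⊆ P'

/-- The family `S` consists of simplices only. -/
def IsSimplicial {d : ℕ} (S : Set (Set (Fin d → ℝ))) : Prop :=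
  ∀ P ∈ S, ∃ V : Finset (Fin d → ℝ),
    AffineIndependent ℝ (fun v : V => (v : Fin d → ℝ)) ∧
    P = convexHull ℝ (V : Set (Fin d → ℝ))

/-- The Delone subdivisions of `L` and `L'` have a common refinement: there are forms `Q`, `Q'`
associated to them and a positive definite form `R` whose Delone subdivision refines both that of
`Q` and that of `Q'`. -/
def HaveCommonDeloneRefinement {d : ℕ} (L L' : Submodule ℤ (Euc d)) : Prop :=
  ∃ Q Q' R : Matrix (Fin d) (Fin d) ℝ,
    IsAssociated Q L ∧ IsAssociated Q' L' ∧ R.PosDef ∧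
    IsRefinement (deloneSubdivision R) (deloneSubdivision Q) ∧
    IsRefinement (deloneSubdivision R) (deloneSubdivision Q')

/-! ### The root lattice `E₈` -/

/-- The root lattice `E₈`: the vectors of `ℤ^8 ∪ (1/2 + ℤ)^8` with even coordinate sum. -/
def latticeE8 : Submodule ℤ (Euc 8) :=
  AddSubgroup.toIntSubmodule
    { carrier := {x | ((∀ i, ∃ n : ℤ, x i = n) ∨ (∀ i, ∃ n : ℤ, x i = 1 / 2 + n)) ∧
        ∃ m : ℤ, ∑ i, x i = 2 * m}
      zero_mem' := ⟨Or.inl fun i => ⟨0, by simp⟩, 0, by simp⟩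
      add_mem' := by
        rintro x y ⟨hx, m, hm⟩ ⟨hy, k, hk⟩
        refine ⟨?_, m + k, ?_⟩
        · rcases hx with hx | hx <;> rcases hy with hy | hy
          · refine Or.inl fun i => ?_
            obtain ⟨a, ha⟩ := hx i
            obtain ⟨b, hb⟩ := hy i
            exact ⟨a + b, by simp [ha, hb]⟩
          · refine Or.inr fun i => ?_
            obtain ⟨a, ha⟩ := hx i
            obtain ⟨b, hb⟩ := hy i
            exact ⟨a + b, by simp [ha, hb]; ring⟩
          · refine Or.inr fun i => ?_
            obtain ⟨a, ha⟩ := hx i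
            obtain ⟨b, hb⟩ := hy i
            exact ⟨a + b, by simp [ha, hb]; ring⟩
          · refine Or.inl fun i => ?_
            obtain ⟨a, ha⟩ := hx i
            obtain ⟨b, hb⟩ := hy i
            exact ⟨a + b + 1, by simp [ha, hb]; ring⟩
        · simp only [PiLp.add_apply, Finset.sum_add_distrib, hm, hk]
          push_cast
          ring
      neg_mem' := by
        rintro x ⟨hx, m, hm⟩
        refine ⟨?_, -m, ?_⟩
        · rcases hx with hx | hx
          · refine Or.inl fun i => ?_
            obtain ⟨a, ha⟩ := hx i
            exact ⟨-a, by simp [ha]⟩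
          · refine Or.inr fun i => ?_
            obtain ⟨a, ha⟩ := hx i
            exact ⟨-a - 1, by simp [ha]; ring⟩
        · simp only [PiLp.neg_apply, Finset.sum_neg_distrib, hm]
          push_cast
          ring }

/-- The basis of `E₈`, as the columns of a matrix: `2 e₁`, `e₂ - e₁`, `e₃ - e₂`, …, `e₇ - e₆`,
`(e₁ + ⋯ + e₈) / 2`. -/
def basisE8 : Matrix (Fin 8) (Fin 8) ℝ :=
  !![2, -1,  0,  0,  0,  0,  0, 1/2;
     0,  1, -1,  0,  0,  0,  0, 1/2;
     0,  0,  1, -1,  0,  0,  0, 1/2;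
     0,  0,  0,  1, -1,  0,  0, 1/2;
     0,  0,  0,  0,  1, -1,  0, 1/2;
     0,  0,  0,  0,  0,  1, -1, 1/2;
     0,  0,  0,  0,  0,  0,  1, 1/2;
     0,  0,  0,  0,  0,  0,  0, 1/2]

/-- The form `Q_{E₈}`, the Gram matrix of the above basis. -/
def formE8 : Matrix (Fin 8) (Fin 8) ℝ := basisE8ᵀ * basisE8

/-- The permutation `σ` of the coordinates of the ambient space of `E₈`, written in coordinates
with respect to the above basis. -/
def permE8 (σ : Equiv.Perm (Fin 8)) : Matrix (Fin 8) (Fin 8) ℝ :=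
  basisE8⁻¹ * σ.permMatrix ℝ * basisE8

/-- The family `S` (of polytopes in basis coordinates) is invariant under the group generated by
the permutations of the last seven coordinates of the ambient space of `E₈` and by `x ↦ -x`. -/
def IsSymmetric (S : Set (Set (Fin 8 → ℝ))) : Prop :=
  (∀ σ : Equiv.Perm (Fin 8), σ 0 = 0 → ∀ P ∈ S, (fun x => permE8 σ *ᵥ x) '' P ∈ S) ∧
  (∀ P ∈ S, (fun x => -x) '' P ∈ S)

/-! ### The form `Q̃` -/

/-- The form `Q₁`. -/
def form1 : Matrix (Fin 8) (Fin 8) ℝ :=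
  !![1,    0,    0,    0,    0,    0,    0, 2;
     0,  4/7, -2/3,    0,    0,    0,    0, 0;
     0, -2/3,  4/3, -2/3,    0,    0,    0, 0;
     0,    0, -2/3,  4/3, -2/3,    0,    0, 0;
     0,    0,    0, -2/3,  4/3, -2/3,    0, 0;
     0,    0,    0,    0, -2/3,  4/3, -2/3, 0;
     0,    0,    0,    0,    0, -2/3,  4/3, 0;
     2,    0,    0,    0,    0,    0,    0, 4]

/-- The form `Q₂`. -/
def form2 : Matrix (Fin 8) (Fin 8) ℝ :=
  !![  0,    1,    0,    0,    0,    0,    0, 7/2;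
       1,    0, -2/3,    0,    0,    0,    0,   0;
       0, -2/3,  4/3, -2/3,    0,    0,    0,   0;
       0,    0, -2/3,  4/3, -2/3,    0,    0,   0;
       0,    0,    0, -2/3,  4/3, -2/3,    0,   0;
       0,    0,    0,    0, -2/3,  4/3, -2/3,   0;
       0,    0,    0,    0,    0, -2/3,  4/3,   0;
     7/2,    0,    0,    0,    0,    0,    0,   7]

/-- The form `Q̃ = 34229189769 Q₁ - 17121746137 Q₂`. -/
def formTilde : Matrix (Fin 8) (Fin 8) ℝ :=
  (34229189769 : ℝ) • form1 - (17121746137 : ℝ) • form2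

end LatticeCovering

end

/-! The proof writes down one periodic system of simplices and shows that convexity across its
facets, a finite check, controls the Delone subdivisions of three forms at once. The system
(`simplex`) is the orbit of 64 explicit simplices with vertices in `E₈` under the permutations of
the last seven coordinates, `x ↦ -x` and the lattice translations.

The power of a point with respect to a simplex is `Q` minus the affine function that interpolates
`Q` at the vertices, that is, the squared distance to the circumcentre minus the squared
circumradius. Powers with respect to two simplices with a common facet differ by an affine function
vanishing on that facet (`power_sub_power`). If the new vertex has positive power, crossing the
facet towards `x` therefore lowers the power of `x`.

This is strict for `R = invariantForm 20 1 (-1) 25`. Only finitely many simplices give `x` an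
`R`-power below a given bound, so a minimiser exists, and no facet of it separates it from `x`.
Hence the simplices cover the space; that their interiors are disjoint is never needed. For a form
`Q` that is weakly convex across the same facets, the same argument aimed at a lattice point `v`
excludes a negative `Q`-power: among the simplices with negative `Q`-power at `v`, one of minimal
`R`-power would contain `v`, hence have it as a vertex, where the power is zero (`power_nonneg`). So
the circumscribed `Q`-ellipsoid of each simplex is empty, and the simplex lies in a Delone polytope
of `Q`. Conversely, a centroid argument places the vertices of each Delone polytope of `R` among
those of one simplex (`exists_vertices_of_isDelonePolytope`). Both refinements and simpliciality
follow.

Three further facts complete the proof. A simplex contains no lattice points besides its vertices,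
because its vertices are at squared distance less than 2 from a common point while nonzero vectors
of `E₈` have norm at least 2. The covering radius for `Q̃` is bounded through approximate
circumcentres of the 64 simplices, and the determinant is read off a triangular decomposition. The
symmetry of `Del(R)` comes from that of `R`. -/

namespace LatticeCovering

section General

variable {d : ℕ}

/-! ### Values of quadratic forms -/

lemma qval_add (Q : Matrix (Fin d) (Fin d) ℝ) (x y : Fin d → ℝ) :
    qval Q (x + y) = qval Q x + (x ⬝ᵥ (Q *ᵥ y) + y ⬝ᵥ (Q *ᵥ x)) + qval Q y := by
  simp only [qval, Matrix.mulVec_add, dotProduct_add, add_dotProduct]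
  ring

lemma qval_neg (Q : Matrix (Fin d) (Fin d) ℝ) (x : Fin d → ℝ) : qval Q (-x) = qval Q x := by
  simp [qval, Matrix.mulVec_neg]

lemma qval_zero (Q : Matrix (Fin d) (Fin d) ℝ) : qval Q 0 = 0 := by simp [qval]

lemma qval_sub_comm (Q : Matrix (Fin d) (Fin d) ℝ) (x y : Fin d → ℝ) :
    qval Q (x - y) = qval Q (y - x) := by
  rw [← neg_sub, qval_neg]

lemma qval_pos {Q : Matrix (Fin d) (Fin d) ℝ} (hQ : Q.PosDef) {x : Fin d → ℝ} (hx : x ≠ 0) :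
    0 < qval Q x := by
  simpa [qval] using hQ.dotProduct_mulVec_pos hx

lemma qval_nonneg {Q : Matrix (Fin d) (Fin d) ℝ} (hQ : Q.PosDef) (x : Fin d → ℝ) :
    0 ≤ qval Q x := by
  rcases eq_or_ne x 0 with rfl | h
  · simp [qval_zero]
  · exact (qval_pos hQ h).le

lemma qval_smul (Q : Matrix (Fin d) (Fin d) ℝ) (a : ℝ) (x : Fin d → ℝ) :
    qval Q (a • x) = a ^ 2 * qval Q x := by
  simp only [qval, Matrix.mulVec_smul, dotProduct_smul, smul_dotProduct, smul_eq_mul]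
  ring

lemma continuous_qval (Q : Matrix (Fin d) (Fin d) ℝ) : Continuous (qval Q) := by
  unfold qval dotProduct Matrix.mulVec dotProduct
  fun_prop

lemma intVec_injective : Function.Injective (intVec (d := d)) := by
  intro v w h
  funext i
  have := congrFun h i
  simpa [intVec] using this

lemma intVec_add (v w : Fin d → ℤ) : intVec (v + w) = intVec v + intVec w := by
  funext i; simp [intVec]

lemma intVec_neg (v : Fin d → ℤ) : intVec (-v) = -intVec v := by
  funext i; simp [intVec]

/-- Parallel axis theorem for weighted points. -/
lemma sum_mul_qval_sub (Q : Matrix (Fin d) (Fin d) ℝ) {ι : Type*} (s : Finset ι)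
    (w : ι → ℝ) (p : ι → Fin d → ℝ) (x c : Fin d → ℝ) (hw : ∑ i ∈ s, w i = 1)
    (hx : ∑ i ∈ s, w i • p i = x) :
    ∑ i ∈ s, w i * qval Q (p i - c) = ∑ i ∈ s, w i * qval Q (p i - x) + qval Q (x - c) := by
  have h0 : ∑ i ∈ s, w i • (p i - x) = 0 := by
    simp only [smul_sub, Finset.sum_sub_distrib, ← Finset.sum_smul, hw, hx, one_smul, sub_self]
  have h1 : ∀ i ∈ s, w i * qval Q (p i - c) = w i * qval Q (p i - x) +
      ((w i • (p i - x)) ⬝ᵥ (Q *ᵥ (x - c)) + (x - c) ⬝ᵥ (Q *ᵥ (w i • (p i - x)))) +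
      w i * qval Q (x - c) := by
    intro i _
    rw [← sub_add_sub_cancel (p i) x c, qval_add]
    simp only [smul_dotProduct, Matrix.mulVec_smul, dotProduct_smul, smul_eq_mul]
    ring
  rw [Finset.sum_congr rfl h1, Finset.sum_add_distrib, Finset.sum_add_distrib,
    Finset.sum_add_distrib, ← sum_dotProduct, ← dotProduct_sum, ← Matrix.mulVec_sum, h0,
    ← Finset.sum_mul, hw]
  simp

/-- A positive definite form dominates a multiple of the square of the norm. -/
lemma exists_pos_mul_norm_sq_le {Q : Matrix (Fin d) (Fin d) ℝ} (hQ : Q.PosDef) :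
    ∃ δ > 0, ∀ x : Fin d → ℝ, δ * ‖x‖ ^ 2 ≤ qval Q x := by
  -- The sphere is empty when `d = 0`. Otherwise the minimum of `Q` on it serves as `δ`, by
  -- homogeneity.
  rcases (Metric.sphere (0 : Fin d → ℝ) 1).eq_empty_or_nonempty with he | hne
  · refine ⟨1, one_pos, fun x => ?_⟩
    rcases eq_or_ne x 0 with rfl | hx
    · simp [qval_zero]
    · exfalso
      have : ‖x‖⁻¹ • x ∈ Metric.sphere (0 : Fin d → ℝ) 1 := by
        simp [norm_smul, inv_mul_cancel₀ (norm_ne_zero_iff.2 hx)]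
      simp [he] at this
  · obtain ⟨z, hz, hmin⟩ := (isCompact_sphere (0 : Fin d → ℝ) 1).exists_isMinOn hne
      (continuous_qval Q).continuousOn
    have hz0 : z ≠ 0 := by
      rintro rfl
      simp at hz
    refine ⟨qval Q z, qval_pos hQ hz0, fun x => ?_⟩
    rcases eq_or_ne x 0 with rfl | hx
    · simp [qval_zero]
    · have hn := norm_ne_zero_iff.2 hx
      have hm : ‖x‖⁻¹ • x ∈ Metric.sphere (0 : Fin d → ℝ) 1 := by
        simp [norm_smul, inv_mul_cancel₀ hn]
      have h1 := hmin hm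
      simp only [Set.mem_ofPred_eq, qval_smul] at h1
      have h2 := mul_le_mul_of_nonneg_right h1 (sq_nonneg ‖x‖)
      calc _ ≤ _ := h2
        _ = qval Q x := by field_simp

lemma finite_qval_sub_le {Q : Matrix (Fin d) (Fin d) ℝ} (hQ : Q.PosDef) (c : Fin d → ℝ) (T : ℝ) :
    {v : Fin d → ℤ | qval Q (intVec v - c) ≤ T}.Finite := by
  obtain ⟨δ, hδ, h⟩ := exists_pos_mul_norm_sq_le hQ
  set M := 1 + T / δ + ‖c‖ with hM
  refine (Set.finite_Icc (fun _ : Fin d => -⌈M⌉) (fun _ => ⌈M⌉)).subset ?_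
  intro v hv
  have h1 : δ * ‖intVec v - c‖ ^ 2 ≤ T := (h _).trans hv
  have h2 : ‖intVec v - c‖ ^ 2 ≤ T / δ := by
    rw [le_div_iff₀ hδ]; linarith
  -- The crude bound `t ≤ 1 + t ^ 2` avoids a square root.
  have h3 : ‖intVec v - c‖ ≤ 1 + T / δ := by nlinarith [sq_nonneg (‖intVec v - c‖ - 1)]
  have h4 : ∀ i, |(v i : ℝ)| ≤ ⌈M⌉ := by
    intro i
    have h5 : ‖intVec v i‖ ≤ ‖intVec v‖ := norm_le_pi_norm _ i
    have h6 : ‖intVec v‖ ≤ ‖intVec v - c‖ + ‖c‖ := by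
      simpa using norm_add_le (intVec v - c) c
    have h7 : |(v i : ℝ)| ≤ M := by
      have : ‖intVec v i‖ = |(v i : ℝ)| := rfl
      linarith
    exact h7.trans (Int.le_ceil _)
  constructor
  · intro i
    have := (abs_le.1 (h4 i)).1
    exact_mod_cast this
  · intro i
    have := (abs_le.1 (h4 i)).2
    exact_mod_cast this

/-! ### The power of a point with respect to a simplex -/

/-- The affine function which interpolates `Q` at the vertices of the simplex `b`. -/
noncomputable def interp (Q : Matrix (Fin d) (Fin d) ℝ)
    (b : AffineBasis (Fin (d + 1)) ℝ (Fin d → ℝ)) : (Fin d → ℝ) →ᵃ[ℝ] ℝ :=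
  ∑ j, qval Q (b j) • b.coord j

/-- The power of the point `x` with respect to the ellipsoid circumscribed to the simplex `b`. -/
noncomputable def power (Q : Matrix (Fin d) (Fin d) ℝ)
    (b : AffineBasis (Fin (d + 1)) ℝ (Fin d → ℝ)) (x : Fin d → ℝ) : ℝ :=
  qval Q x - interp Q b x

variable (Q : Matrix (Fin d) (Fin d) ℝ) (b b' : AffineBasis (Fin (d + 1)) ℝ (Fin d → ℝ))

lemma affineMap_eq_sum_coord (f : (Fin d → ℝ) →ᵃ[ℝ] ℝ) (x : Fin d → ℝ) :
    f x = ∑ j, b.coord j x * f (b j) := by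
  have h := Finset.univ.map_affineCombination (b : Fin (d + 1) → Fin d → ℝ)
    (fun j => b.coord j x) (b.sum_coord_apply_eq_one x) f
  rw [b.affineCombination_coord_eq_self, Finset.affineCombination_eq_linear_combination _ _ _
    (b.sum_coord_apply_eq_one x)] at h
  simpa using h

lemma interp_apply (x : Fin d → ℝ) :
    interp Q b x = ∑ j, b.coord j x * qval Q (b j) := by
  have : ∀ s : Finset (Fin (d + 1)),
      (∑ j ∈ s, qval Q (b j) • b.coord j) x = ∑ j ∈ s, b.coord j x * qval Q (b j) := by
    intro s
    induction s using Finset.cons_induction with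
    | empty => simp
    | cons a s ha ih =>
      rw [Finset.sum_cons, Finset.sum_cons, AffineMap.coe_add, Pi.add_apply, ih,
        AffineMap.coe_smul, Pi.smul_apply, smul_eq_mul, mul_comm]
  exact this _

/-- Moving the origin to `c` changes `Q` by an affine function, which interpolation reproduces; the
power is thus independent of the origin, and `c` may be chosen to suit each use. -/
lemma power_eq (x c : Fin d → ℝ) :
    power Q b x = qval Q (x - c) - ∑ j, b.coord j x * qval Q (b j - c) := by
  have h := fun c => sum_mul_qval_sub Q Finset.univ (fun j => b.coord j x) b x c
    (b.sum_coord_apply_eq_one x) (b.linear_combination_coord_eq_self x)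
  have h0 := h 0
  simp only [sub_zero] at h0
  rw [power, interp_apply, h c, h0]
  ring

lemma power_apply_self (j : Fin (d + 1)) : power Q b (b j) = 0 := by
  rw [power_eq Q b (b j) (b j)]
  simp [AffineBasis.coord_apply, qval_zero]

/-- The quadratic parts cancel, so the difference is affine. It vanishes at the vertices of the
common facet and is therefore a multiple of the barycentric coordinate of the opposite vertex. -/
lemma power_sub_power (x : Fin d → ℝ) (i : Fin (d + 1))
    (h : ∀ j, j ≠ i → ∃ j', b' j' = b j) :
    power Q b' x - power Q b x = b.coord i x * power Q b' (b i) := by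
  have h1 := affineMap_eq_sum_coord b (interp Q b - interp Q b') x
  have h2 : ∀ j, (interp Q b - interp Q b') (b j) = power Q b' (b j) := by
    intro j
    have := power_apply_self Q b j
    simp only [power, AffineMap.coe_sub, Pi.sub_apply] at this ⊢
    linarith
  simp only [h2] at h1
  rw [Finset.sum_eq_single i] at h1
  · rw [← h1]
    simp [power]
  · intro j _ hj
    obtain ⟨j', hj'⟩ := h j hj
    rw [← hj', power_apply_self, mul_zero]
  · simp

/-- If a new vertex beyond a facet has nonnegative power with respect to a simplex, then passing
to the simplex spanned by the facet and the new vertex does not increase the powers of the points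
beyond the facet. -/
lemma power_neighbor_le {i j₀ : Fin (d + 1)} {x : Fin d → ℝ}
    (h : ∀ j, j ≠ i → ∃ j', b' j' = b j) (hc : b.coord i (b' j₀) < 0)
    (hp : 0 ≤ power Q b (b' j₀)) (hx : b.coord i x < 0) : power Q b' x ≤ power Q b x := by
  -- The identity is used at `x` and at the new vertex. At the latter the power for `b'` is zero,
  -- which fixes the sign of the power of the old vertex `b i` with respect to `b'`.
  have h1 := power_sub_power Q b b' x i h
  have h2 := power_sub_power Q b b' (b' j₀) i h
  rw [power_apply_self] at h2
  have h3 : 0 ≤ power Q b' (b i) := by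
    by_contra hneg
    nlinarith [mul_pos_of_neg_of_neg hc (not_le.1 hneg)]
  nlinarith

/-- The strict version is what contradicts minimality of the `R`-power in the arguments below. -/
lemma power_neighbor_lt {i j₀ : Fin (d + 1)} {x : Fin d → ℝ}
    (h : ∀ j, j ≠ i → ∃ j', b' j' = b j) (hc : b.coord i (b' j₀) < 0)
    (hp : 0 < power Q b (b' j₀)) (hx : b.coord i x < 0) : power Q b' x < power Q b x := by
  have h1 := power_sub_power Q b b' x i h
  have h2 := power_sub_power Q b b' (b' j₀) i h
  rw [power_apply_self] at h2
  have h3 : 0 < power Q b' (b i) := by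
    by_contra hneg
    nlinarith [mul_nonneg_of_nonpos_of_nonpos hc.le (not_lt.1 hneg)]
  nlinarith

/-- The circumscribed ellipsoid of a simplex. -/
lemma exists_circumcenter {Q : Matrix (Fin d) (Fin d) ℝ} (hQ : Q.PosDef) :
    ∃ (c : Fin d → ℝ) (r : ℝ), ∀ x, power Q b x = qval Q (x - c) - r ^ 2 := by
  classical
  set f := interp Q b
  set w : Fin d → ℝ := fun i => f.linear (Pi.single i 1) with hw
  have hf : ∀ x, f x = w ⬝ᵥ x + f 0 := by
    intro x
    have h1 : f x = f.linear x + f 0 := by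
      conv_lhs => rw [f.decomp]
      simp
    rw [h1, add_left_inj, LinearMap.pi_apply_eq_sum_univ f.linear x]
    simp only [hw, dotProduct, smul_eq_mul]
    refine Finset.sum_congr rfl fun i _ => ?_
    rw [mul_comm]
    congr 2
    funext j
    simp [Pi.single_apply, eq_comm]
  have hdet : IsUnit Q.det := hQ.det_pos.ne'.isUnit
  -- Completing the square: `w` is the gradient of the interpolating function, and the centre solves
  -- `2 Q c = w`.
  set c : Fin d → ℝ := Q⁻¹ *ᵥ ((1 / 2 : ℝ) • w) with hc
  have hQc : Q *ᵥ c = (1 / 2 : ℝ) • w := by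
    rw [hc, Matrix.mulVec_mulVec, Matrix.mul_nonsing_inv _ hdet, Matrix.one_mulVec]
  have hsymm : Qᵀ = Q := by simpa [Matrix.IsSymm] using hQ.isHermitian
  have hcQ : ∀ x, c ⬝ᵥ (Q *ᵥ x) = (1 / 2 : ℝ) * (w ⬝ᵥ x) := by
    intro x
    rw [Matrix.dotProduct_mulVec, ← Matrix.mulVec_transpose, hsymm, hQc, smul_dotProduct,
      smul_eq_mul]
  have key : ∀ x, power Q b x = qval Q (x - c) - (f 0 + qval Q c) := by
    intro x
    rw [power, sub_eq_add_neg x c, qval_add, qval_neg, Matrix.mulVec_neg, dotProduct_neg,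
      neg_dotProduct, hcQ, hQc, dotProduct_smul, smul_eq_mul, dotProduct_comm x w, hf x]
    ring
  refine ⟨c, Real.sqrt (f 0 + qval Q c), fun x => ?_⟩
  rw [Real.sq_sqrt, key]
  -- A vertex has power zero, so the radicand equals the value of `Q` at `b 0 - c`; it is
  -- nonnegative and the square root is a genuine one.
  have h0 := key (b 0)
  rw [power_apply_self] at h0
  linarith [qval_nonneg hQ (b 0 - c)]

/-- A point of a simplex has a vertex at distance at most `√M` if all vertices have distance at
most `√M` from some point `c`. -/
lemma exists_qval_sub_le_of_coord_nonneg {Q : Matrix (Fin d) (Fin d) ℝ} (hQ : Q.PosDef) {M : ℝ}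
    (c : Fin d → ℝ) (hM : ∀ j, qval Q (b j - c) ≤ M) {x : Fin d → ℝ}
    (hx : ∀ j, 0 ≤ b.coord j x) : ∃ j, qval Q (b j - x) ≤ M := by
  by_contra hall
  push Not at hall
  -- The weighted mean of the squared distances from the vertices to `x` is that to `c` minus `Q[x -
  -- c]`, hence at most `M`. So `c` need not be the exact circumcentre.
  have h := sum_mul_qval_sub Q Finset.univ (fun j => b.coord j x) b x c
    (b.sum_coord_apply_eq_one x) (b.linear_combination_coord_eq_self x)
  have h1 : ∑ j, b.coord j x * qval Q (b j - c) ≤ M := by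
    calc _ ≤ ∑ j, b.coord j x * M :=
          Finset.sum_le_sum fun j _ => mul_le_mul_of_nonneg_left (hM j) (hx j)
      _ = M := by rw [← Finset.sum_mul, b.sum_coord_apply_eq_one, one_mul]
  have h2 : M < ∑ j, b.coord j x * qval Q (b j - x) := by
    calc M = ∑ j, b.coord j x * M := by
          rw [← Finset.sum_mul, b.sum_coord_apply_eq_one, one_mul]
      _ < _ := by
          refine Finset.sum_lt_sum
            (fun j _ => mul_le_mul_of_nonneg_left (hall j).le (hx j)) ?_
          by_contra hno
          push Not at hno
          have h0 : ∀ j, b.coord j x ≤ 0 := by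
            intro j
            by_contra hj
            exact absurd (hno j (Finset.mem_univ j))
              (not_le.2 (mul_lt_mul_of_pos_left (hall j) (not_le.1 hj)))
          have := Finset.sum_nonpos fun j (_ : j ∈ Finset.univ) => h0 j
          rw [b.sum_coord_apply_eq_one] at this
          linarith
  linarith [qval_nonneg hQ (x - c)]

/-! ### Locally convex systems of simplices -/

/-- A system of simplices with integral vertices in which every simplex has a neighbour across
each of its facets, the form `R` being strictly convex across all facets. -/
structure IsDeloneSystem {ι : Type*} (b : ι → AffineBasis (Fin (d + 1)) ℝ (Fin d → ℝ))
    (R : Matrix (Fin d) (Fin d) ℝ) : Prop where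
  nonempty : Nonempty ι
  posDef : R.PosDef
  integral : ∀ S j, ∃ v, b S j = intVec v
  isVertex : ∀ S v, (∀ j, 0 ≤ (b S).coord j (intVec v)) → ∃ j, b S j = intVec v
  finite : ∀ x T, {S | power R (b S) x ≤ T}.Finite
  neighbor : ∀ S i, ∃ S', (∀ j, j ≠ i → ∃ j', b S' j' = b S j) ∧
    ∃ j', (b S).coord i (b S' j') < 0 ∧ 0 < power R (b S) (b S' j')

/-- The form `Q` is convex across all facets of the system of simplices. -/
def IsConvexOn {ι : Type*} (b : ι → AffineBasis (Fin (d + 1)) ℝ (Fin d → ℝ))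
    (Q R : Matrix (Fin d) (Fin d) ℝ) : Prop :=
  ∀ S i, ∃ S', (∀ j, j ≠ i → ∃ j', b S' j' = b S j) ∧
    ∃ j', (b S).coord i (b S' j') < 0 ∧ 0 < power R (b S) (b S' j') ∧ 0 ≤ power Q (b S) (b S' j')

namespace IsDeloneSystem

variable {ι : Type*} {b : ι → AffineBasis (Fin (d + 1)) ℝ (Fin d → ℝ)}
  {R Q : Matrix (Fin d) (Fin d) ℝ}

/-- Only the finitely many members of `T` whose power at `x` does not exceed that of a chosen one
compete for the minimum. -/
lemma exists_min (h : IsDeloneSystem b R) (x : Fin d → ℝ) (T : Set ι) (hT : T.Nonempty) :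
    ∃ S ∈ T, ∀ S' ∈ T, power R (b S) x ≤ power R (b S') x := by
  obtain ⟨S₀, hS₀⟩ := hT
  obtain ⟨S, ⟨hS, hST⟩, hmin⟩ := Set.exists_min_image
    ({S | power R (b S) x ≤ power R (b S₀) x} ∩ T) (fun S => power R (b S) x)
    ((h.finite x _).inter_of_left T) ⟨S₀, (le_refl (power R (b S₀) x) : _), hS₀⟩
  refine ⟨S, hST, fun S' hS' => ?_⟩
  by_cases hle : power R (b S') x ≤ power R (b S₀) x
  · exact hmin S' ⟨hle, hS'⟩
  · exact le_trans hS (not_le.1 hle).le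

/-- The simplices of the system cover the space. -/
lemma exists_coord_nonneg (h : IsDeloneSystem b R) (x : Fin d → ℝ) :
    ∃ S, ∀ j, 0 ≤ (b S).coord j x := by
  have := h.nonempty
  -- A simplex of minimal `R`-power at `x` contains `x`: beyond a facet separating it from `x` the
  -- neighbour would have smaller power.
  obtain ⟨S, -, hS⟩ := h.exists_min x Set.univ Set.univ_nonempty
  refine ⟨S, fun i => ?_⟩
  by_contra hi
  obtain ⟨S', hf, j', hc, hp⟩ := h.neighbor S i
  exact absurd (hS S' trivial) (not_le.2 (power_neighbor_lt R _ _ hf hc hp (not_le.1 hi)))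

/-- Local convexity becomes global. Crossing a separating facet keeps a negative `Q`-power negative
and strictly lowers the `R`-power; so weak convexity of `Q` suffices, as `R` provides the
termination. -/
lemma power_nonneg (h : IsDeloneSystem b R) (hQ : IsConvexOn b Q R) (S : ι) (v : Fin d → ℤ) :
    0 ≤ power Q (b S) (intVec v) := by
  by_contra hneg
  obtain ⟨S, hS, hmin⟩ := h.exists_min (intVec v) {S | power Q (b S) (intVec v) < 0}
    ⟨S, not_le.1 hneg⟩
  have hv : ∀ j, 0 ≤ (b S).coord j (intVec v) := by
    intro i
    by_contra hi
    obtain ⟨S', hf, j', hc, hR, hp⟩ := hQ S i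
    have h1 := power_neighbor_le Q _ _ hf hc hp (not_le.1 hi)
    have h2 := power_neighbor_lt R _ _ hf hc hR (not_le.1 hi)
    exact absurd (hmin S' (lt_of_le_of_lt h1 hS)) (not_le.2 h2)
  obtain ⟨j, hj⟩ := h.isVertex S v hv
  rw [Set.mem_ofPred_eq, ← hj, power_apply_self] at hS
  exact lt_irrefl _ hS

lemma power_nonneg_self (h : IsDeloneSystem b R) (S : ι) (v : Fin d → ℤ) :
    0 ≤ power R (b S) (intVec v) := by
  refine h.power_nonneg (fun S i => ?_) S v
  obtain ⟨S', hf, j', hc, hp⟩ := h.neighbor S i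
  exact ⟨S', hf, j', hc, hp, hp.le⟩

/-- If some facet separated `v` from the simplex, the strict drop across it would make the power of
`v` negative for the neighbour. -/
lemma eq_vertex_of_power_eq_zero (h : IsDeloneSystem b R) (S : ι) (v : Fin d → ℤ)
    (hv : power R (b S) (intVec v) = 0) : ∃ j, b S j = intVec v := by
  by_contra hne
  have hco : ∃ i, (b S).coord i (intVec v) < 0 := by
    by_contra hall
    push Not at hall
    exact hne (h.isVertex S v hall)
  obtain ⟨i, hi⟩ := hco
  obtain ⟨S', hf, j', hc, hp⟩ := h.neighbor S i
  have h1 := power_neighbor_lt R _ _ hf hc hp hi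
  linarith [h.power_nonneg_self S' v]

/-- Let `S` contain the centroid `x` of `V`. The vertices of `S` lie outside or on the empty
ellipsoid of `V`, so the power of `x` is at most `R[x - c] - r ^ 2`. By the parallel axis theorem
the mean of the powers of the points of `V` is then nonpositive. These powers are nonnegative, so
all vanish and the points are vertices of `S`. -/
lemma exists_vertices_of_isDelonePolytope (h : IsDeloneSystem b R) {V : Finset (Fin d → ℤ)}
    (hV : V.Nonempty) {c : Fin d → ℝ} {r : ℝ} (h1 : ∀ v ∈ V, qval R (intVec v - c) = r ^ 2)
    (h2 : ∀ v : Fin d → ℤ, v ∉ V → r ^ 2 < qval R (intVec v - c)) :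
    ∃ S, ∀ v ∈ V, ∃ j, b S j = intVec v := by
  have hcard : (0 : ℝ) < V.card := by exact_mod_cast hV.card_pos
  set w : (Fin d → ℤ) → ℝ := fun _ => (V.card : ℝ)⁻¹ with hw
  set x := ∑ v ∈ V, w v • intVec v with hx
  have hw1 : ∑ v ∈ V, w v = 1 := by
    simp [hw, hcard.ne']
  obtain ⟨S, hS⟩ := h.exists_coord_nonneg x
  obtain ⟨c', ρ, hρ⟩ := exists_circumcenter (b S) h.posDef
  have e1 := sum_mul_qval_sub R V w intVec x c hw1 hx.symm
  have e2 := sum_mul_qval_sub R V w intVec x c' hw1 hx.symm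
  have f1 := power_eq R (b S) x c
  have hle : ∀ j, (b S).coord j x * r ^ 2 ≤ (b S).coord j x * qval R (b S j - c) := by
    intro j
    refine mul_le_mul_of_nonneg_left ?_ (hS j)
    obtain ⟨v, hv⟩ := h.integral S j
    rw [hv]
    by_cases hvV : v ∈ V
    · exact (h1 v hvV).ge
    · exact (h2 v hvV).le
  have hge := Finset.sum_le_sum fun j (_ : j ∈ Finset.univ) => hle j
  rw [← Finset.sum_mul, AffineBasis.sum_coord_apply_eq_one, one_mul] at hge
  have e1' : ∑ v ∈ V, w v * qval R (intVec v - c) = r ^ 2 := by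
    rw [Finset.sum_congr rfl fun v hv => by rw [h1 v hv], ← Finset.sum_mul, hw1, one_mul]
  have e2' : ∑ v ∈ V, w v * power R (b S) (intVec v) =
      ∑ v ∈ V, w v * qval R (intVec v - c') - ρ ^ 2 := by
    simp only [hρ, mul_sub, Finset.sum_sub_distrib, ← Finset.sum_mul, hw1, one_mul]
  have hsum : ∑ v ∈ V, w v * power R (b S) (intVec v) ≤ 0 := by
    have := hρ x
    linarith
  have hnn : ∀ v ∈ V, 0 ≤ w v * power R (b S) (intVec v) := fun v _ =>
    mul_nonneg (inv_nonneg.2 hcard.le) (h.power_nonneg_self S v)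
  have hz := (Finset.sum_eq_zero_iff_of_nonneg hnn).1
    (le_antisymm hsum (Finset.sum_nonneg hnn))
  refine ⟨S, fun v hv => h.eq_vertex_of_power_eq_zero S v ?_⟩
  exact (mul_eq_zero.1 (hz v hv)).resolve_left (inv_pos.2 hcard).ne'

/-- The Delone subdivision of the form of a Delone system consists of simplices. -/
theorem isSimplicial (h : IsDeloneSystem b R) : IsSimplicial (deloneSubdivision R) := by
  classical
  rintro P ⟨V, hV, rfl, c, r, h1, h2⟩
  obtain ⟨S, hS⟩ := h.exists_vertices_of_isDelonePolytope hV h1 h2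
  refine ⟨V.image intVec, ?_, by simp⟩
  have hind := (b S).ind.range
  refine hind.mono ?_
  intro y hy
  simp only [Finset.coe_image, Set.mem_image, Finset.mem_coe] at hy
  obtain ⟨v, hv, rfl⟩ := hy
  exact hS v hv

/-- The Delone subdivision of the form of a Delone system refines the Delone subdivision of every
form which is convex on the system. -/
theorem isRefinement (h : IsDeloneSystem b R) (hQ : Q.PosDef) (hQR : IsConvexOn b Q R) :
    IsRefinement (deloneSubdivision R) (deloneSubdivision Q) := by
  rintro P ⟨V, hV, rfl, c, r, h1, h2⟩
  obtain ⟨S, hS⟩ := h.exists_vertices_of_isDelonePolytope hV h1 h2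
  obtain ⟨c', ρ, hρ⟩ := exists_circumcenter (b S) hQ
  -- All lattice points in the closed `Q`-ellipsoid of `S` are taken. By `power_nonneg` none is in
  -- the interior, so they span a Delone polytope of `Q`.
  have hfin := finite_qval_sub_le hQ c' (ρ ^ 2)
  have hsub : ∀ v ∈ V, v ∈ hfin.toFinset := by
    intro v hv
    obtain ⟨j, hj⟩ := hS v hv
    have h0 := power_apply_self Q (b S) j
    rw [hj, hρ] at h0
    simp only [Set.Finite.mem_toFinset, Set.mem_ofPred_eq]
    linarith
  refine ⟨_, ⟨hfin.toFinset, hV.mono hsub, rfl, c', ρ, ?_, ?_⟩, ?_⟩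
  · intro v hv
    simp only [Set.Finite.mem_toFinset, Set.mem_ofPred_eq] at hv
    have := h.power_nonneg hQR S v
    rw [hρ] at this
    linarith
  · intro v hv
    simpa using hv
  · exact convexHull_mono (Set.image_mono hsub)

/-- A bound for the distance to the nearest lattice point in terms of approximate circumcentres
of the simplices. -/
theorem exists_qval_sub_le (h : IsDeloneSystem b R) (hQ : Q.PosDef) {M : ℝ} (c : ι → Fin d → ℝ)
    (hM : ∀ S j, qval Q (b S j - c S) ≤ M) (x : Fin d → ℝ) :
    ∃ v : Fin d → ℤ, qval Q (x - intVec v) ≤ M := by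
  obtain ⟨S, hS⟩ := h.exists_coord_nonneg x
  obtain ⟨j, hj⟩ := exists_qval_sub_le_of_coord_nonneg (b S) hQ (c S) (hM S) hS
  obtain ⟨v, hv⟩ := h.integral S j
  exact ⟨v, by rw [qval_sub_comm, ← hv]; exact hj⟩

end IsDeloneSystem

end General

/-! ### The representative simplices -/

/-- The vertices of the representative simplices, in base `8`. -/
def vertexCodes : List ℕ := [
  56417311858519285485607379507273375976278765536019877472691102866,
  56417311858519285485607379507273375976278765536019877472693499611,
  56417311858519285485607379507273375976278765536019917683332555922,
  56417311858519285485607379507273375976278765536010870273436361874,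
  56417311858519285485607379507273375976278766210634613329819973339,
  56417311858519285485607379507273375976278765536010910484077814930,
  56417311858519285485607379507273375976278765536010870273438758605,
  56417311858519285485607379507273375976277556610191255644261655698,
  56417311858519285485607379507273375976278766210634613329517983451,
  56417311858519285485607379507273375987595865540800406518345086683,
  56417311858519285485607379507273375987595779863580012018989081746,
  56417311858519285485607379507273375987595779863579971808350025421,
  56417311858519285485607379507273375976277556610191255644264052299,
  56417311858519285485607379507273375976277556610191295852487189650,
  56417311858519285485607379507273213717000727396827864066251367570,
  56417311858519285485607379507273375987595780538203714864429250267,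
  56417311858519285485607379507273375987595865540800406518345086539,
  56417311858519285485607379507273375987595865540800446726570620635,
  56417311858519285485607379507463103430684286807242653435582854875,
  56417311858519285485607379507463102004577275873264182252435743890,
  56417311858519285485607379507463092021828799075957605255258945229,
  56417311858519285485607379507463092010510575822568889091172972107,
  56417311858519285485607379507463092010510575822568929299396109458,
  56417311858519285485607379507273213717000727396827864066253763149,
  56417311858519285485607379507273213717000727396827904257330586770,
  56417311858519285485607379507463102004577276547887885097875912411,
  56417311858519285485607379507463092021828884753178039965254006347,
  56417311858519285485607379507463092021828884753178080173479540443,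
  56417311858519285485607379507463103430684286807242653435582853709,
  56417311858519285485607379507463103430684286807242693626662074075,
  56417311858519285485607379507463102004577275873264182232873510034,
  56417311858519285485607379507463102004577276547567606785320232082,
  56417311858519285485610543526018272658580931340073471148684813458,
  56417311858519285485607379507463092021828799075957645448452093645,
  56417311858519285485610543358535535206933054556887204556184598221,
  56417311858519285485610543358535535195614831303498488392098625099,
  56417311858519285485610541994747611520291145704192484752688227474,
  56417311858519285485610541994557733226781297278451419519545881165,
  56417311858519285485607379507463102004577276547887925289257121499,
  56417311858519285485610543358535535206933140234107639266179659339,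
  56417311858519285485613727815300369049803257469854327241232463579,
  56417311858519285485613727815300380458658659523918900503335776845,
  56417311858519285485607379507463102004577276547567606765757998226,
  56417311858519285485610541994747621514357845754887737686165628050,
  56417311858519285485607379507463102004577276547567606785322627661,
  56417311858519285485610541994747621514357846429191162238612350098,
  56417311858519285485610543526018272658580931340073470991650071698,
  56417311858519285485610543526018272658580932012066549072728237202,
  56417311858519285485613727815300369049803171792633892516205016781,
  56417311858519285485610543358535535206933054556887284820499871437,
  56417311858519285485610543358535535206890147135023850959772956365,
  56417311858519285485610543358535535195614831303498488392098615883,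
  56417311858519285485610543358535535195614831303498528445705336395,
  56417311858519335985714946302939307397349781271225060129858200722,
  56417311858519285485613727815300379032551649264564172357010044635,
  56417311858519285485610543358535535206933140234107639266182046868,
  56417311858519285485610543358535535206933140234107719530494932555,
  56417311858519389434917682975770426286886984415484100269434582747,
  56417311858519285485610541994747621514357846429191162219050116242,
  56417311858519285485610541994747621514357845754887737686170412180,
  56417311858519285485613727815300379032551649264243853853075550797,
  56417311858519285485610541994747621514357846429191162238617134228,
  56417311858519389252182190998457752729697897848740261086810940562,
  56417311858519285485610543526018272658580931340073470991654855828]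

/-- The gradients of the barycentric coordinates of the representative simplices, in base `32`. -/
def gradientCodes : List ℕ := [
  2017095040850131795374123034022135254995276159232360804200616285381987080701065499588373954576503207598794025,
  1789816726388147934610624911752199413636339138370265332841846191362741046012555005060096861501699102422521525,
  1865576164550686503008815696847327024231001624083633672636721213490025339839317425185501438592836262253999525,
  2017095040850131795374123034022135254995276159232360804200616285381987080701065498659918925112890213889517225,
  1789816726388147934610624911752199413636339138370265332841846191362741046269824938799339087039580002232912850,
  1789816726811073367723349756507074755649671336957422875268453235345754018334141574804071452189246016050311750,
  1865576164815548895463249438006945925289856132289732335570555927903629423354344004680655314927632996716105075,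
  2017095040850131795374123034022135254995276159232360804200616285381954413593841088567426441164087563023341225,
  1789816726811073367723349756507074755649671336957422875268453235345754018334141575282572091114133537591740800,
  1789816726388147934610624911752199413636339138370265332841846474233993023596217988300261902536468696088964975,
  1789816726811073367723349756507074755649671336957422875268453518217005469157613341239049257575643062903124550,
  1789816739921761794217819943908210358062969493159306690493271881690391285419917834642079340878042273990402450,
  1789816739921761794217819943908210358062969493159306690493271598819123484963462961502605478481963095003145525,
  1865576173573095742746945718284667653848755193942994577737671485127602743437514592473524678766251701551154725,
  2017095040850131795374123034022135254995276159232360803051244629732537769825080818204694553882378785613600425,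
  1789816726811073367723349756507074755649671336957422875268453518217005469286248293956809236703644063733640675,
  1789816739921761794217819943908210358062969493159306690493271881690408129654350355763718032929148333245041775,
  1714057297265106502237946970104710426276130513368264263498491705319390031669394990382374509282732325794797225,
  1789816726388147934610624911752199413636339138370576351959105308024686953606055709985998084377525561708012300,
  1789816726811073367723349756507074755649671336957733894385133597359316361483207912005465065299482665722196550,
  1789816739921761794217819943908210358062969493159617709592010425297716787137641587037719100086062720062415250,
  1789816739921761794217819943908210358062969493159617709592010283861560213193823588988160921904906489111196050,
  1789817159886716875153590785499424977301842690207057338638101593149085180340845037439292422146115311976431075,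
  1865576453532644567083410124001846073057970367789281297651592964657702375051849830112495058889572615472917875,
  1789817159886716875153590785499424977301842690206746318964694618301588101061122718990363630046201239057084800,
  1789816726811073367723349756507074755649671336957733894385133597359316361740477356448789770469134883367969350,
  1789816739921761794217819943908210358062969493159617709592010566732844857884710983249273476352091727353092300,
  1562538845424733014390092663229489135942905669345272887545962271441234364121819929220478959820009272249734825,
  1714057577224655326574411375821888845485345687214862003679043674289600237062328220069929951350071698566456625,
  1562538845424733014390092663229489135942905669344961867872555296593737284842097610771667160541348015151496675,
  1789817159886716875153590785499424977301842690207057339230746635964599755343443180611805680631714013109230150,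
  1714057577241743222861794197832186839102045978066868369029034901216287904326950584173499911504341365144665575,
  1789816726811073367723349756507074755991601296035600681906437288457690111806343646068345479324743490511188550,
  1714057577506605615316227938991805740160900486272967031944928221530017823360839284697638616454788642275775925,
  1789816739921761794217819943908210358404899432510713065789949352424055550679955498611728996407914445824156050,
  1789816739921761794217819943908210358404899432510713065789949352406807318065466969775814457134210087764475375,
  1789817159886716875153590785499424977643771997664963935515055593846580398742103720205411408426617871981038150,
  1789830598342354031985532871663417451274361884655001906278490059314541182848291213277715333108121764987548050,
  1562538845424733014390092663229489135942905669344961867871976541945353720912202620751225842558403801452625775,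
  1789816739921761794217819943908210358404899432510713065789949635278091962756354364036927011581395326006371625,
  1562538845424733014390092663229489136626805376437238953297156868154295564098645951628066077411306920689850025,
  1562552283880370171222034749393481610257395263427432434193906578342311635094132440724779525886072858942416175,
  1789817159886716875153590785499424977301842690207057339230746635964599755600712625504967783741984771958678825,
  1789817159886716875153590785499424977643771997665119427554457633695177213084398696798620376857135951056774825,
  1562538845424733014390092663229489135942905669344961867871976541945353720912202130976690690890313357499809275,
  1562552283906002015653108982408928600682445699666875469156967029443527827739825824316972836494100728624168425,
  1714066536494118282824905485111432049873270807490113921793958328461461865005063889438513605801528352681999975,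
  1562552283906002015653108982408928600340496171631748808857957765643521662074105512501459807145329577879387625,
  1562552284303295604334759594148356952270727461378242511075433324462449890437562198287940800349758556751975925,
  1562552284303295604334759594148356951928777914214125371917403820610926977285402770089596304373520186807604725,
  1714066536477030386537522663101134056256570496911336125102082330216157940896425127600183332529747796673877425,
  1789830598342354031985532871663417451274382736489063300849566587775875921593011252354891979238158535587118575,
  1714066545234577233821218943378855784815469558564598367269197604586111693137629371089493358978588061084595625,
  1789817159886716875153591160076285374896983594619982340353481393048678915547278377841876244117328550851565225,
  1562538845424733014390092663229489136626805376437238935203243380411552447118024472603684208245377241439518575,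
  1562552283880370171222034749393481609915445715626967829490796776627914531595388152087727440610539668652742325,
  1562547668926587993312220195198898557242844877989868053030017824777898981369509768998577175137574316970454375,
  1562538845424733014390093413806780286904963525911493298441417579087420188139432069034455952604075061310445225,
  1789817159886716875153590785499424977643771997665119427554457633695177213341668141691782479967406709906223500,
  1562552284303295604334759594148356951928777282321092104061117143896131494378583815878430786244097323784918325,
  1562538845424733014390092663229489136626805376437238935203243380411552447118023982829149056577286797486702075,
  1562552283906002015653108982408928600340485736131095125735856668426519059721365308846101018679248675793255925,
  1562552283906002015653109732963987648283561437483017190136790223447867889944704647675984306179058074209730025,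
  1562552284303295604334759594148356951928777933940896803258709837263927787089391149840560709095454285659356475]

/-- The neighbours of the representative simplices, in base `10`. -/
def neighborCodes : List ℕ := [
  30176543202876543100307165432082765431003076154320872654310030765143208762543100307654132087652431003076543120876542310030765432108765432100207654321087654321001076543210876543210,
  40176543202876543100407165432082765431004076154320872654310040765143208762543100407654132087652431004076543120876542310040765432108765432100207654321087654320100076543210876543210,
  50176543202876543100507165432082765431005076154320872654310050765143208762543100507654132087652431005076543120876542310050765432108765432100007654321087654321001076543210876543201,
  70276543103876542100707265431083765421007076254310873654210070765243108763542100707654231087653421007076543210876543210000765432108765432100507654321087654321006076543210876543210,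
  90276543103876542100907265431083765421009076254310873654210090765243108763542100907654231087653421009076543210876543210010765432108765432100807654321087654321006076543210876543012,
  100276543103876542101007265431083765421010076254310873654210100765243108763542101007654231087653421010076543210876543210020765432108765432100307654321087654321008076543210876543102,
  110276543103876542101107265431083765421011076254310873654210110765243108763542101107654231087653421011076543210876543210040765432108765430120807654321087654310203076543210876543210,
  140376542104876532101407365421084765321014076354210874653210140765342108764532101407654321087654321003076543210876543210030765431208765423101307654321087654321012076543210876543210,
  150276543103876542101507265431083765421015076254310873654210150765243108763542101507654231087653421015076543210876543210050765432108765430210407654321087654321006076543210876543021,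
  180376542104876532101807365421084765321018076354210874653210180765342108764532101807654321087654321004076543210876543210040765431208765423101707654321087654321016076543210876543210,
  190376542104876532101907365421084765321019076354210874653210190765342108764532101907654321087654321005076543210876543210100765431208765432101307654321087654123015076543210876543102,
  200376542104876532102007365421084765321020076354210874653210200765342108764532102007654321087654321006076543210876543210160765432108765403121507654321087654310212076543210876540213,
  210376542104876532102107365421084765321021076354210874653210210765342108764532102107654321087654321011076543210876540213110765431208765420131307654321087654320107076543210876543210,
  220376542104876532102207365421084765321022076354210874653210220765342108764532102207654321087654321010076543210876541230100765431208765421300707654321087654321012076543210876543201,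
  141732165408432765011413721654048327650114132716540438276501141321765404328765010707654321087654321007076542310876534210070765421308765324102407654321087654321023076543210876543210,
  250376542104876532102507365421084765321025076354210874653210250765342108764532102507654321087654321008076543210876543210100765432108765430211707654321087654123011076543210876543021,
  260376542104876532102607365421084765321026076354210874653210260765342108764532102607654321087654321011076543210876542013110765431208765402131707654321087654320109076543210876543210,
  270376542104876532102707365421084765321027076354210874653210270765342108764532102707654321087654321015076543210876541230150765431208765421300907654321087654321016076543210876543201,
  181732165408432765011813721654048327650118132716540438276501181321765404328765010907654321087654321009076542310876534210090765421308765324102907654321087654321028076543210876543210,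
  320476532105876432103207465321085764321032076453210875643210320765432108765432101007654321087654321010076542310876534210310765432108765432103007654321087654321025076543210876543102,
  340476532105876432103407465321085764321034076453210875643210340765432108765432101107654321087654321020076542310876543210260765432108765403123307654321087654321021076543210876540213,
  350476532105876432103507465321085764321035076453210875643210350765432108765432101207654321087654321020076543210876540213200765431208765420132207654321087654320123076543210876503214,
  360476532105876432103607465321085764321036076453210875643210360765432108765432101307654321087654321030076543210876514230300765431208765124302407654321087651324021076543210876543201,
  370476532105876432103707465321085764321037076453210875643210370765432108765432102107654321087650321421076542310876530214210765421308765320142407654321087654320114076543210876543210,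
  371432176500432876513713421765040328765137132417650430287651371321476504320876512207654321087651324022076542310876531240220765421308765321401407654321087654321023076543210876543201,
  321743265108543760123214732651058437601232143726510548376012321432765105438760121507654321087654321015076542310876534210190765432108765430213807654321087654321033076543210876513024,
  390476532105876432103907465321085764321039076453210875643210390765432108765432101607654321087654321020076543210876542013200765431208765402132707654321087654320128076543210876503214,
  400476532105876432104007465321085764321040076453210875643210400765432108765432101707654321087654321038076543210876514230380765431208765124302907654321087651324026076543210876543201,
  410476532105876432104107465321085764321041076453210875643210410765432108765432102607654321087650321426076542310876530214260765421308765320142907654321087654320118076543210876543210,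
  411432176500432876514113421765040328765141132417650430287651411321476504320876512707654321087651324027076542310876531240270765421308765321401807654321087654321028076543210876543201,
  430476532105876432104307465321085764321043076453210875643210430765432108765432102207654321087653124022076542310876513240420765432108765432101907654321087654321033076543210876513240,
  450476532105876432104507465321085764321045076453210875643210450765432108765432101907654312087652341019076541320876532410190765432108765432104207654321087654321044076543210876543210,
  251732654108437650122513726541048376501225132765410438765012190765432108765432101907653421087645321019076532410876435210470765432108765432104607654321087654321032143276510543876120,
  480476532105876432104807465321085764321048076453210875643210480765432108765432102507654321087650314220076542310876541230380765432108765130422007654321087654321030076543210876513240,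
  341743651208547610323414736512058476103234143765120548761032200765432108765432102007653421087645321050076543210876543210390765432108765403124907654321087654321035076543210876540213,
  391743652108547623013914736521058476230139143765210548762301210765432108765432102107653421087645321034076543210876540213340765431208765420135207654321087654321051076543210876543210,
  530576432106875432105307564321086754321053076543210876543210220765432108765432103607653421087654321043076543210876514230430765431208765124303713214765043205768152076543210876143205,
  361321476501324876053612314765031248760536121347650321487605230765432108765432105107654321087605321451076542310876035214510765421308760325143713214765043208761524132176540432176508,
  540476532105876432105407465321085764321054076453210875643210540765432108765432102707654321087653124027076542310876513240440765432108765432012507654321087654321033076543210876513042,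
  351743652108547623013514736521058476230135143765210548762301260765432108765432102607653421087645321034076543210876542013340765431208765402135607654321087654321055076543210876543210,
  570576432106875432105707564321086754321057076543210876543210270765432108765432104007653421087654321054076543210876514230540765431208765124304113214765043205768156076543210876143205,
  401321476501324876054012314765031248760540121347650321487605280765432108765432105507654321087605321455076542310876035214550765421308760325144113214765043208761529132176540432176508,
  580476532105876432105807465321085764321058076453210875643210580765432108765432103007654312087652341030076541320876532410300765432108765432103107654321087654321044076543210876543201,
  531754621308657231045315746213068572310453154762130658723104300765432108765432103607654321087653124036076542310876513240580765432108765432104607654321087614325059076543210876543210,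
  600476532105876432106007465321085764321060076453210875643210600765432108765432103807654312087652340138076541320876532401380765432108765432014207654321087654320131076543210876543210,
  620576432106875432106207564321086754321062076543210876543210310765432108765432104707654312087625341047076541320876235410470765432108762435105807654321087654321061076543210876543210,
  541432765101438760525413427651041387605254132476510431876052430765432108761432504307653421087641325043076532410876431250470765432108765431203207654321087654321063076543210876543210,
  481432765104138765204813427651014387652048132476510134876520450765432108762435104507653421087642351045076532410876432510320765432108765432104607654321087654312063143276510543876021,
  621432576102435671806213425761042356718062132457610432567180330765432108765432104714327651054328617049076542310876145230540765432108765130424907654321087614325059076543210876013245,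
  591176324506783410255917163245076834102559176132450786341025480765432108761432504807653421087641325061032176540342786510560765432108765403123407654321087654321062032176540342786510,
  590132765402347865105903127654032478651059032176540342786510340765423108763452103407652431087643521034076543210876543210600321765403427861056103217654034278651058032176540342786510,
  531321547601325687045312315476031256870453121354760321568704370765432108764032153707653421087604321558032176540342786510580321764503427856105207654321087654320135076543210876543210,
  570354217604563278105705342176054632781057054321760564327810360765432108760432513607653421087640325162032176540342781506620321764503427851063507654321087654321051076543210876543201,
  431746513208576034214314765132058760342136076543210876543210360764532108756432105602176543023786541053154762130658702134531547623106587012345112143765032450768157176213540782315640,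
  571754621308657231045715746213068572310457154762130658723104380765432108765432104007654321087653124040076542310876513240600765432108765432014614327651054317608248076543210876513042,
  571321547601325687045712315476031256870457121354760321568704410765432108764032154107653421087604321560032176540342786501600321764503427856015607654321087654320139076543210876543210,
  530354217604563278105305342176054632781053054321760564327810400765432108760432514007653421087640325149076543210876542013490765431208765402133907654321087654321055076543210876543201,
  541746513208576034215414765132058760342140076543210876543210400764532108756432105202176543023786541057154762130658702134571547623106587012345512143765032450768153176213540782315640,
  510243176503452786105104231765043527861051043217650453278610420765432108765432104307654312087652341043076541320876532410430765432108765432104507654321087654321050043217650453278610,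
  491176243506780451324917162435076804513249176124350786045132480765432108760132456203217654034207658162032175640342067581500432176504532786106307654321087614325043076543210876543210,
  550243176503452786015504231765043527860155043217650453278601440765432108765432105407654312087652340154076541320876532401540765432108765432015004321765045307862161076543210876043215,
  490243176503452786104904231765043527861049043217650453278610600765432108760432156314327615054308672163143271650543068721631432765105430768215004321765045327861045076543210876543210,
  590342176504132786055904321765014327860545076543210876543210620764532108765432104813247615013458672048132471650134568720481324765101345768205204321765045027863149043217650453278610,
  611432765102438761056113427651042387610561132476510432876105590765432108761432505907653421087641325059076532410876431250631432765105438762014714327651054387610246076543210876543210]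

/-- Approximate circumcentres of the representative simplices, in base `10 ^ 7`. -/
def centerCodes : List ℕ := [
  12855951285595128559512855951285595128559512855953000835,
  12855951285595128559512855951285595128559512855953000835,
  12855951285595128559512855951285595128559512855953000835,
  12650671265067126506712650671265067126506708375713000597,
  14079241407924140792414079241407924140792409804283143454,
  13975411397541139754113975411397541139754107562972858456,
  13534631353463135346313534631353463135346307834683095755,
  12445401244540124454012445401244540081704308170433000358,
  13975411397541139754113975411397541139754107562972858456,
  15302541530254153025415302541530254110275711027573286072,
  14914871491487149148714914871491487113273206708642738970,
  14728291472829147282914728291472829072094806522073262700,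
  14498581449858144985814498581449858066360606636063239729,
  13812851381285138128513812851381285071461807146182841178,
  12240121224012122401212240120796516079651607965163000119,
  14914871491487149148714914871491487113273206708642738970,
  14958001495800149580014958001495800070954907095493285672,
  15870751587075158707515870751587075092040909204093046968,
  16525841652584165258416525841225087122508712250873428691,
  15854321585432158543215854321226677122667705854322619485,
  15406971540697154069715406971255699064631705775763357620,
  15177261517726151772615177261232728058897505889753334649,
  14933761493376149337614933760707125056462605646262666309,
  13743101374310137431013743100660143066014306601433191233,
  14492181449218144921814492180591717059171705917172713689,
  15854321585432158543215854321226677122667705854322619485,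
  15636681563668156366815636681278671063491806349183380592,
  18743291874329187432918743291088077094557809455783047261,
  17070841707084170708417070840992918099291809929183524007,
  18777901877790187779018777901020289102028910202893142260,
  15375341537534153753415375340680033068003305375342618928,
  16973791697379169737916973790911127091112709111272477105,
  16793781679378167937813206221320622132062205000002500000,
  16567211656721165672116567210965469096546904904732951705,
  16085651608565160856513235671323567057168605029453452540,
  15855931585593158559313005961300596051434405143443429569,
  15390861539086153908613253370645960050346105034612594999,
  14694481469448146944807188200505072050507205050723357620,
  18708681870868187086818708681013367101336708708682952262,
  16315361631536163153613465391346539056028705602873475511,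
  19914671991467199146717777181098341095584209558423047380,
  19694481969448196944812188201005072100507210050723857620,
  15816921581692158169215816920652942065294206529422571548,
  15832441583244158324413694950618868061886804763702547619,
  18674071867407186740718674070938656093865609386562857262,
  19585871958587195858712104680922962092296209229622144886,
  17383151738315173831510241491024149102414903812322381232,
  19585871958587195858710667151066715106671507792092144886,
  19298441929844192984411104760965469096546902173502951705,
  19264031926403192640310345311034531088952402139093048295,
  17279311727931172793109416790941679094167903716843619485,
  15306121530612153061206731110673111045936304593633428929,
  16579421657942165794209912750991275039585803958583047792,
  15847951584795137104713710470584795044229604422962523690,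
  19880061988006198800617742571023630102363008811322952381,
  19591841959184195918411016831101683088793408879343857501,
  19589711958971195897112923041292304069688706968873348821,
  21086052108605189485618948561108605096610609661063047500,
  16274021627402162740214136530591777059177705917772500239,
  19298441929844192984411104760965469096546902173502951705,
  19845451984545198454517707960948920094892009489202857382,
  19585871958587195858712104680922962092296209229622144886,
  20345312034531188952412139090926403092640309264032048295,
  19332851933285193328510414131041413104141302207912855114]

/-- The `c`-th coordinate of the `j`-th vertex of the `k`-th simplex. -/
def vtx (k : Fin 64) (j : Fin 9) (c : Fin 8) : ℤ :=
  (vertexCodes.getD k 0 / 8 ^ (8 * j.val + c.val) % 8 : ℕ) - 2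

/-- The gradient of `24` times the `j`-th barycentric coordinate of the `k`-th simplex. -/
def grad (k : Fin 64) (j : Fin 9) (c : Fin 8) : ℤ :=
  (gradientCodes.getD k 0 / 32 ^ (8 * j.val + c.val) % 32 : ℕ) - 15

/-- `10 ^ 6` times the approximate circumcentre of the `k`-th simplex. -/
def center (k : Fin 64) (c : Fin 8) : ℤ :=
  (centerCodes.getD k 0 / (10 ^ 7) ^ c.val % 10 ^ 7 : ℕ) - 10 ^ 6

/-- The code of the neighbour of the `k`-th simplex across its `i`-th facet. -/
def facetCode (k : Fin 64) (i : Fin 9) : ℕ :=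
  neighborCodes.getD k 0 / (10 ^ 20) ^ i.val % 10 ^ 20

/-- The representative of the neighbour. -/
def nbr (k : Fin 64) (i : Fin 9) : Fin 64 := Fin.ofNat 64 (facetCode k i / 10 ^ 18)

/-- The sign of the symmetry which takes the representative to the neighbour. -/
def nbrSign (k : Fin 64) (i : Fin 9) : ℤ := 1 - 2 * (facetCode k i / 10 ^ 17 % 10 : ℕ)

/-- The permutation of the symmetry which takes the representative to the neighbour. -/
def nbrPerm (k : Fin 64) (i : Fin 9) (c : Fin 8) : Fin 8 :=
  Fin.ofNat 8 (facetCode k i / 10 ^ (9 + c.val) % 10)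

/-- The numbering of the vertices of the neighbour. -/
def nbrVtx (k : Fin 64) (i j : Fin 9) : Fin 9 :=
  Fin.ofNat 9 (facetCode k i / 10 ^ j.val % 10)

/-- The image of the `j`-th vertex of the neighbouring representative under its signed
permutation. -/
def nbrImage (k : Fin 64) (i j : Fin 9) (c : Fin 8) : ℤ :=
  nbrSign k i * vtx (nbr k i) (nbrVtx k i j) (nbrPerm k i c)

/-- The translation which takes the signed permutation of the representative to the neighbour. -/
def nbrShift (k : Fin 64) (i : Fin 9) (c : Fin 8) : ℤ :=
  if i = 0 then vtx k 1 c - nbrImage k i 1 c else vtx k 0 c - nbrImage k i 0 c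

/-- The vertex of the neighbour beyond the facet. -/
def newVtx (k : Fin 64) (i : Fin 9) (c : Fin 8) : ℤ := nbrImage k i i c + nbrShift k i c

/-- A sum of eight terms, written out. -/
def sum8 (f : Fin 8 → ℤ) : ℤ := f 0 + f 1 + f 2 + f 3 + f 4 + f 5 + f 6 + f 7

/-- The integral invariant form with the given coefficients. -/
def intForm (a b c d : ℤ) (y : Fin 8 → ℤ) : ℤ :=
  a * (y 0 * y 0) + b * (y 0 * (sum8 y - y 0)) + c * ((sum8 y - y 0) * (sum8 y - y 0)) +
    d * (sum8 (fun i => y i * y i) - y 0 * y 0)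

/-- `24` times the `j`-th barycentric coordinate with respect to the `k`-th simplex. -/
def bary (k : Fin 64) (j : Fin 9) (y : Fin 8 → ℤ) : ℤ :=
  24 + sum8 (fun c => grad k j c * (y c - vtx k j c))

/-- `24` times the power with respect to the `k`-th simplex. -/
def intPower (a b c d : ℤ) (k : Fin 64) (y : Fin 8 → ℤ) : ℤ :=
  24 * intForm a b c d y -
    (bary k 0 y * intForm a b c d (vtx k 0) + bary k 1 y * intForm a b c d (vtx k 1) +
      bary k 2 y * intForm a b c d (vtx k 2) + bary k 3 y * intForm a b c d (vtx k 3) +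
      bary k 4 y * intForm a b c d (vtx k 4) + bary k 5 y * intForm a b c d (vtx k 5) +
      bary k 6 y * intForm a b c d (vtx k 6) + bary k 7 y * intForm a b c d (vtx k 7) +
      bary k 8 y * intForm a b c d (vtx k 8))

/-! ### Verification of the finite data in integer arithmetic -/

lemma vtx_mem : ∀ k j, (∀ c, (2 : ℤ) ∣ vtx k j c - vtx k j 0) ∧ (4 : ℤ) ∣ sum8 (vtx k j) := by
  decide +kernel

/-- This duality certifies both that the nine vertices are affinely independent and that `bary` is
`24` times the barycentric coordinates. -/
lemma bary_vtx : ∀ k i j, bary k i (vtx k j) = if i = j then 24 else 0 := by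
  decide +kernel

lemma nbrPerm_spec :
    ∀ k i, nbrPerm k i 0 = 0 ∧ ∀ c c', nbrPerm k i c = nbrPerm k i c' → c = c' := by
  decide +kernel

lemma nbrSign_eq : ∀ k i, nbrSign k i = 1 ∨ nbrSign k i = -1 := by
  decide +kernel

/-- The translation is defined by one common vertex; the content is that it matches the other seven
vertices of the facet. -/
lemma nbrImage_add_nbrShift :
    ∀ k i j, j ≠ i → ∀ c, nbrImage k i j c + nbrShift k i c = vtx k j c := by
  decide +kernel

/-- The local convexity conditions. The three coefficient vectors belong to `R`, to `E₈` and to `84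
Q̃`; strictness is required for `R` only. -/
lemma newVtx_spec : ∀ k i, bary k i (newVtx k i) < 0 ∧
    0 < intPower 20 1 (-1) 25 k (newVtx k i) ∧ 0 ≤ intPower 1 0 0 1 k (newVtx k i) ∧
    0 ≤ intPower 718812985149 (-600705210) (-34429424839) 958016843392 k (newVtx k i) := by
  decide +kernel

/-- Both bounds use the same approximate centres. The factor `336 = 4 * 84` accounts for doubled
coordinates and for `84 Q̃`, so the first bound says that the squared distance for `Q̃` is at most
`10000010000`. The second says that the squared distance for `E₈` is less than `2`. -/
lemma intForm_center : ∀ k j,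
    intForm 718812985149 (-600705210) (-34429424839) 958016843392
      (fun c => 10 ^ 6 * vtx k j c - center k c) ≤ 336 * 10000010000 * 10 ^ 12 ∧
    intForm 1 0 0 1 (fun c => 10 ^ 6 * vtx k j c - center k c) < 8 * 10 ^ 12 := by
  decide +kernel

/-! ### Forms which are invariant under the permutations fixing the first coordinate -/

/-- The Gram matrix of the form `a x₁² + b x₁ s + c s² + d (x₂² + ⋯ + x₈²)`, `s = x₂ + ⋯ + x₈`. -/
noncomputable def ambientForm (a b c d : ℝ) : Matrix (Fin 8) (Fin 8) ℝ :=
  Matrix.of fun i j =>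
    if i = 0 then (if j = 0 then a else b / 2)
    else if j = 0 then b / 2 else if i = j then c + d else c

/-- The form `ambientForm` in basis coordinates. -/
noncomputable def invariantForm (a b c d : ℝ) : Matrix (Fin 8) (Fin 8) ℝ :=
  basisE8ᵀ * ambientForm a b c d * basisE8

lemma qval_ambientForm (a b c d : ℝ) (y : Fin 8 → ℝ) :
    qval (ambientForm a b c d) y = a * y 0 ^ 2 + b * (y 0 * (∑ i, y i - y 0)) +
      c * (∑ i, y i - y 0) ^ 2 + d * (∑ i, y i ^ 2 - y 0 ^ 2) := by
  simp only [qval, ambientForm, dotProduct, Matrix.mulVec, Matrix.of_apply, Fin.sum_univ_eight]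
  simp only [Fin.reduceEq, if_true, if_false]
  ring

lemma qval_invariantForm (a b c d : ℝ) (x : Fin 8 → ℝ) :
    qval (invariantForm a b c d) x = qval (ambientForm a b c d) (basisE8 *ᵥ x) := by
  simp only [qval, invariantForm, ← Matrix.mulVec_mulVec, Matrix.dotProduct_mulVec,
    Matrix.vecMul_transpose]

lemma det_basisE8 : basisE8.det = 1 := by
  rw [Matrix.det_of_isUpperTriangular]
  · simp [basisE8, Fin.prod_univ_succ]
  · intro i j hij
    fin_cases i <;> fin_cases j <;> first | rfl | (exfalso; revert hij; decide)

lemma ambientForm_one : ambientForm 1 0 0 1 = 1 := by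
  ext i j
  simp only [ambientForm, Matrix.of_apply, Matrix.one_apply]
  split_ifs <;> simp_all

lemma formE8_eq : formE8 = invariantForm 1 0 0 1 := by
  rw [formE8, invariantForm, ambientForm_one, Matrix.mul_one]

/-- An intermediate product, so that each entry of `invariantForm_eq` is a single sum of eight
terms. -/
lemma ambientForm_mul_basisE8 (a b c d : ℝ) : ambientForm a b c d * basisE8 =
    !![2 * a, b / 2 - a, 0, 0, 0, 0, 0, a / 2 + 7 / 4 * b;
       b, c + d - b / 2, -d, 0, 0, 0, 0, b / 4 + (7 * c + d) / 2;
       b, c - b / 2, d, -d, 0, 0, 0, b / 4 + (7 * c + d) / 2;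
       b, c - b / 2, 0, d, -d, 0, 0, b / 4 + (7 * c + d) / 2;
       b, c - b / 2, 0, 0, d, -d, 0, b / 4 + (7 * c + d) / 2;
       b, c - b / 2, 0, 0, 0, d, -d, b / 4 + (7 * c + d) / 2;
       b, c - b / 2, 0, 0, 0, 0, d, b / 4 + (7 * c + d) / 2;
       b, c - b / 2, 0, 0, 0, 0, 0, b / 4 + (7 * c + d) / 2] := by
  ext i j
  rw [Matrix.mul_apply, Fin.sum_univ_eight]
  fin_cases i <;> fin_cases j <;>
    simp [ambientForm, basisE8] <;> ring

lemma invariantForm_eq (a b c d : ℝ) : invariantForm a b c d =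
    !![4 * a, b - 2 * a, 0, 0, 0, 0, 0, a + 7 / 2 * b;
       b - 2 * a, a - b + c + d, -d, 0, 0, 0, 0, (7 * c + d - 3 * b - a) / 2;
       0, -d, 2 * d, -d, 0, 0, 0, 0;
       0, 0, -d, 2 * d, -d, 0, 0, 0;
       0, 0, 0, -d, 2 * d, -d, 0, 0;
       0, 0, 0, 0, -d, 2 * d, -d, 0;
       0, 0, 0, 0, 0, -d, 2 * d, 0;
       a + 7 / 2 * b, (7 * c + d - 3 * b - a) / 2, 0, 0, 0, 0, 0,
         (a + 7 * b + 7 * (7 * c + d)) / 4] := by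
  rw [invariantForm, Matrix.mul_assoc, ambientForm_mul_basisE8]
  ext i j
  rw [Matrix.mul_apply, Fin.sum_univ_eight]
  fin_cases i <;> fin_cases j <;>
    simp [basisE8] <;> ring

/-- This places `Q̃` among the forms invariant under the permutations of the last seven coordinates,
so that it can be tested on the 64 representatives alone. -/
lemma smul_form1_sub_smul_form2 (p q : ℝ) : p • form1 - q • form2 =
    invariantForm (p / 4) (p / 2 - q) (13 / 84 * p - q / 3) (2 / 3 * (p - q)) := by
  rw [invariantForm_eq, form1, form2]
  ext i j
  rw [Matrix.sub_apply, Matrix.smul_apply, Matrix.smul_apply]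
  fin_cases i <;> fin_cases j <;> simp <;> ring

lemma formTilde_eq : formTilde =
    invariantForm (34229189769 / 4) (-14302505 / 2) (-34429424839 / 84) (34214887264 / 3) := by
  rw [formTilde, smul_form1_sub_smul_form2]
  norm_num

lemma isHermitian_invariantForm (a b c d : ℝ) : (invariantForm a b c d).IsHermitian := by
  have h : (ambientForm a b c d)ᵀ = ambientForm a b c d := by
    ext i j
    simp only [ambientForm, Matrix.transpose_apply, Matrix.of_apply, eq_comm (a := j) (b := i)]
    by_cases hi : i = 0 <;> by_cases hj : j = 0 <;> simp [hi, hj]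
  rw [Matrix.IsHermitian, Matrix.conjTranspose_eq_transpose_of_trivial, invariantForm,
    Matrix.transpose_mul, Matrix.transpose_mul, Matrix.transpose_transpose, h, Matrix.mul_assoc]

lemma basisE8_mulVec_ne_zero {x : Fin 8 → ℝ} (hx : x ≠ 0) : basisE8 *ᵥ x ≠ 0 := by
  intro h
  exact hx (Matrix.eq_zero_of_mulVec_eq_zero (by rw [det_basisE8]; exact one_ne_zero) h)

/-- For fixed `y 0` and `s`, Cauchy–Schwarz bounds the sum of the other squares below by `s ^ 2 /
7`. What remains is a binary form in `y 0` and `s`, and the last hypothesis is its discriminant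
condition. -/
lemma posDef_invariantForm {a b c d : ℝ} (ha : 0 < a) (hd : 0 < d)
    (h : 7 * b ^ 2 < 4 * a * (7 * c + d)) : (invariantForm a b c d).PosDef := by
  refine Matrix.PosDef.of_dotProduct_mulVec_pos (isHermitian_invariantForm a b c d)
    fun x hx => ?_
  have hy := basisE8_mulVec_ne_zero hx
  have hval := (qval_invariantForm a b c d x).trans (qval_ambientForm a b c d _)
  rw [star_trivial]
  change 0 < qval _ x
  rw [hval]
  set y := basisE8 *ᵥ x
  have hs : ∑ i, y i - y 0 = ∑ i : Fin 7, y i.succ := by rw [Fin.sum_univ_succ]; ring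
  have hn : ∑ i, y i ^ 2 - y 0 ^ 2 = ∑ i : Fin 7, y i.succ ^ 2 := by
    rw [Fin.sum_univ_succ]; ring
  rw [hs, hn]
  have hcs : (∑ i : Fin 7, y i.succ) ^ 2 ≤ 7 * ∑ i : Fin 7, y i.succ ^ 2 := by
    simpa using sq_sum_le_card_mul_sum_sq (s := (Finset.univ : Finset (Fin 7)))
      (f := fun i => y i.succ)
  set s := ∑ i : Fin 7, y i.succ
  set n := ∑ i : Fin 7, y i.succ ^ 2 with hndef
  have key : 4 * a * 7 * (a * y 0 ^ 2 + b * (y 0 * s) + c * s ^ 2 + d * n) =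
      7 * (2 * a * y 0 + b * s) ^ 2 + (4 * a * (7 * c + d) - 7 * b ^ 2) * s ^ 2 +
        4 * a * d * (7 * n - s ^ 2) := by ring
  have hnn : 0 ≤ 4 * a * d * (7 * n - s ^ 2) :=
    mul_nonneg (by positivity) (by linarith)
  have hs0 : 0 ≤ (4 * a * (7 * c + d) - 7 * b ^ 2) * s ^ 2 :=
    mul_nonneg (by linarith) (sq_nonneg s)
  by_contra hle
  have hle' : 4 * a * 7 * (a * y 0 ^ 2 + b * (y 0 * s) + c * s ^ 2 + d * n) ≤ 0 :=
    mul_nonpos_of_nonneg_of_nonpos (by positivity) (not_lt.1 hle)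
  have hq := sq_nonneg (2 * a * y 0 + b * s)
  have e1 : s ^ 2 = 0 := (mul_eq_zero.1 (by linarith :
    (4 * a * (7 * c + d) - 7 * b ^ 2) * s ^ 2 = 0)).resolve_left (by linarith)
  have e2 : 7 * n - s ^ 2 = 0 := (mul_eq_zero.1 (by linarith :
    4 * a * d * (7 * n - s ^ 2) = 0)).resolve_left (by positivity)
  have e3 : (2 * a * y 0 + b * s) ^ 2 = 0 := by linarith
  have e4 : s = 0 := by simpa using e1
  have e5 : y 0 = 0 := by
    have := pow_eq_zero_iff (two_ne_zero) |>.1 e3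
    rw [e4, mul_zero, add_zero] at this
    exact (mul_eq_zero.1 this).resolve_left (by positivity)
  have e6 : n = 0 := by rw [e1] at e2; linarith
  have e7 := (Finset.sum_eq_zero_iff_of_nonneg (fun i _ => sq_nonneg (y (Fin.succ i)))).1
    (hndef.symm.trans e6)
  refine hy (funext fun i => ?_)
  refine Fin.cases e5 (fun i => ?_) i
  simpa using e7 i (Finset.mem_univ i)

lemma posDef_formE8 : formE8.PosDef := by
  rw [formE8_eq]
  exact posDef_invariantForm (by norm_num) (by norm_num) (by norm_num)

lemma posDef_formTilde : formTilde.PosDef := by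
  rw [formTilde_eq]
  exact posDef_invariantForm (by norm_num) (by norm_num) (by norm_num)

/-! ### The lattice `E₈` in basis coordinates -/

lemma basisE8_mulVec (u : Fin 8 → ℝ) : basisE8 *ᵥ u =
    ![2 * u 0 - u 1 + u 7 / 2, u 1 - u 2 + u 7 / 2, u 2 - u 3 + u 7 / 2, u 3 - u 4 + u 7 / 2,
      u 4 - u 5 + u 7 / 2, u 5 - u 6 + u 7 / 2, u 6 + u 7 / 2, u 7 / 2] := by
  funext i
  rw [Matrix.mulVec, dotProduct, Fin.sum_univ_eight]
  fin_cases i <;> simp [basisE8] <;> ring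

/-- The form of `E₈` is even. -/
lemma exists_qval_formE8 (v : Fin 8 → ℤ) : ∃ m : ℤ, qval formE8 (intVec v) = 2 * m := by
  refine ⟨2 * v 0 ^ 2 + v 1 ^ 2 + v 2 ^ 2 + v 3 ^ 2 + v 4 ^ 2 + v 5 ^ 2 + v 6 ^ 2 + v 7 ^ 2 -
    2 * v 0 * v 1 - v 1 * v 2 - v 2 * v 3 - v 3 * v 4 - v 4 * v 5 - v 5 * v 6 + v 0 * v 7, ?_⟩
  rw [formE8_eq, qval_invariantForm, qval_ambientForm, basisE8_mulVec]
  simp only [Fin.sum_univ_eight, intVec]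
  simp only [Matrix.cons_val]
  push_cast
  ring

lemma mem_latticeE8 {x : Euc 8} : x ∈ latticeE8 ↔
    ((∀ i, ∃ n : ℤ, x i = n) ∨ (∀ i, ∃ n : ℤ, x i = 1 / 2 + n)) ∧ ∃ m : ℤ, ∑ i, x i = 2 * m :=
  Iff.rfl

/-- The lattice `E₈` is generated by the columns of `basisE8`. -/
lemma mem_latticeE8_iff {x : Euc 8} :
    x ∈ latticeE8 ↔ ∃ v : Fin 8 → ℤ, WithLp.toLp 2 (basisE8 *ᵥ intVec v) = x := by
  rw [mem_latticeE8]
  constructor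
  · rintro ⟨hx, m, hm⟩
    rw [Fin.sum_univ_eight] at hm
    rcases hx with hx | hx <;> choose n hn using hx
    -- The triangular system is solved from the last coordinate upwards; the first entry is integral
    -- because the coordinate sum is `2 * m`. The half-integral case replaces `n i` by `n i + 1 /
    -- 2`.
    · refine ⟨![m - 4 * n 7, n 1 + n 2 + n 3 + n 4 + n 5 + n 6 - 6 * n 7,
        n 2 + n 3 + n 4 + n 5 + n 6 - 5 * n 7, n 3 + n 4 + n 5 + n 6 - 4 * n 7,
        n 4 + n 5 + n 6 - 3 * n 7, n 5 + n 6 - 2 * n 7, n 6 - n 7, 2 * n 7], ?_⟩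
      rw [basisE8_mulVec]
      simp only [hn] at hm
      ext i
      fin_cases i <;> simp [intVec, hn] <;> linarith
    · refine ⟨![m - 2 - 4 * n 7, n 1 + n 2 + n 3 + n 4 + n 5 + n 6 - 6 * n 7,
        n 2 + n 3 + n 4 + n 5 + n 6 - 5 * n 7, n 3 + n 4 + n 5 + n 6 - 4 * n 7,
        n 4 + n 5 + n 6 - 3 * n 7, n 5 + n 6 - 2 * n 7, n 6 - n 7, 1 + 2 * n 7], ?_⟩
      rw [basisE8_mulVec]
      simp only [hn] at hm
      ext i
      fin_cases i <;> simp [intVec, hn] <;> linarith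
  · rintro ⟨v, rfl⟩
    rw [basisE8_mulVec]
    -- In `basisE8 *ᵥ v` the differences telescope, and the coordinate sum is `2 * v 0 + 4 * v 7`;
    -- the parity of `v 7` decides between integral and half-integral coordinates.
    refine ⟨?_, v 0 + 2 * v 7, ?_⟩
    · rcases Int.even_or_odd' (v 7) with ⟨k, hk | hk⟩
      · refine Or.inl fun i => ⟨![2 * v 0 - v 1 + k, v 1 - v 2 + k, v 2 - v 3 + k, v 3 - v 4 + k,
          v 4 - v 5 + k, v 5 - v 6 + k, v 6 + k, k] i, ?_⟩
        fin_cases i <;> simp [intVec, hk]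
      · refine Or.inr fun i => ⟨![2 * v 0 - v 1 + k, v 1 - v 2 + k, v 2 - v 3 + k, v 3 - v 4 + k,
          v 4 - v 5 + k, v 5 - v 6 + k, v 6 + k, k] i, ?_⟩
        fin_cases i <;> simp [intVec, hk] <;> ring
    · simp only [Fin.sum_univ_eight, intVec]
      simp only [Matrix.cons_val]
      push_cast
      ring

lemma isAssociated_formE8 : IsAssociated formE8 latticeE8 := by
  refine ⟨basisE8, by rw [det_basisE8]; exact one_ne_zero, ?_, rfl⟩
  ext x
  exact mem_latticeE8_iff

/-! ### Simplices from dual affine functions, and their images under affine maps -/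

section Transport

variable {d : ℕ} (b : AffineBasis (Fin (d + 1)) ℝ (Fin d → ℝ))

/-- Simplices from vertices and barycentric coordinates. -/
lemma affineIndependent_of_coord {p : Fin (d + 1) → Fin d → ℝ}
    (f : Fin (d + 1) → (Fin d → ℝ) →ᵃ[ℝ] ℝ) (hf : ∀ i j, f i (p j) = if i = j then 1 else 0) :
    AffineIndependent ℝ p := by
  rw [affineIndependent_iff]
  intro s w hw hp i hi
  have h1 : ∀ j, f i (p j) = (f i).linear (p j) + f i 0 := by
    intro j
    conv_lhs => rw [(f i).decomp]
    simp
  have h2 : ∑ j ∈ s, w j * f i (p j) = 0 := by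
    simp only [h1, mul_add, Finset.sum_add_distrib, ← Finset.sum_mul, hw, zero_mul, add_zero]
    have := congrArg (f i).linear hp
    simpa using this
  simpa [hf, hi] using h2

/-- The simplex with given vertices and barycentric coordinates. -/
noncomputable def simplexOfCoord (p : Fin (d + 1) → Fin d → ℝ)
    (f : Fin (d + 1) → (Fin d → ℝ) →ᵃ[ℝ] ℝ) (hf : ∀ i j, f i (p j) = if i = j then 1 else 0) :
    AffineBasis (Fin (d + 1)) ℝ (Fin d → ℝ) where
  toFun := p
  ind' := affineIndependent_of_coord f hf
  tot' := (affineIndependent_of_coord f hf).affineSpan_eq_top_iff_card_eq_finrank_add_one.2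
    (by simp)

lemma coord_simplexOfCoord {p : Fin (d + 1) → Fin d → ℝ}
    {f : Fin (d + 1) → (Fin d → ℝ) →ᵃ[ℝ] ℝ} (hf : ∀ i j, f i (p j) = if i = j then 1 else 0)
    (i : Fin (d + 1)) (x : Fin d → ℝ) : (simplexOfCoord p f hf).coord i x = f i x := by
  rw [affineMap_eq_sum_coord (simplexOfCoord p f hf) (f i) x]
  have : ∀ j, f i (simplexOfCoord p f hf j) = if i = j then 1 else 0 := hf i
  simp [this]

/-- The image of a simplex under an affine transformation. -/
noncomputable def movedSimplex (t : Fin d → ℝ) (g : (Fin d → ℝ) ≃ₗ[ℝ] (Fin d → ℝ)) :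
    AffineBasis (Fin (d + 1)) ℝ (Fin d → ℝ) :=
  t +ᵥ (g • b)

lemma movedSimplex_apply (t : Fin d → ℝ) (g : (Fin d → ℝ) ≃ₗ[ℝ] (Fin d → ℝ)) (j : Fin (d + 1)) :
    movedSimplex b t g j = t + g (b j) := rfl

lemma coord_movedSimplex (t : Fin d → ℝ) (g : (Fin d → ℝ) ≃ₗ[ℝ] (Fin d → ℝ)) (j : Fin (d + 1))
    (x : Fin d → ℝ) : (movedSimplex b t g).coord j (t + g x) = b.coord j x := by
  have : DistribMulAction.toLinearEquiv ℝ (Fin d → ℝ) g = g := by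
    ext; rfl
  simp [movedSimplex, AffineBasis.coord_vadd, AffineBasis.coord_smul, this]

/-- Powers are invariant under similarities. -/
lemma power_movedSimplex {Q Q' : Matrix (Fin d) (Fin d) ℝ} {a : ℝ} (t : Fin d → ℝ)
    (g : (Fin d → ℝ) ≃ₗ[ℝ] (Fin d → ℝ)) (hg : ∀ y, qval Q (g y) = a * qval Q' y)
    (x : Fin d → ℝ) : power Q (movedSimplex b t g) (t + g x) = a * power Q' b x := by
  rw [power_eq Q _ _ (t + g x), power_eq Q' b x x]
  simp only [sub_self, qval_zero, zero_sub, mul_neg, Finset.mul_sum, neg_inj]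
  refine Finset.sum_congr rfl fun j _ => ?_
  rw [coord_movedSimplex, movedSimplex_apply, add_sub_add_left_eq_sub, ← map_sub, hg]
  ring

end Transport

/-! ### The representative simplices over the reals -/

/-- The barycentric coordinates of the representative simplices. -/
noncomputable def baryMap (k : Fin 64) (j : Fin 9) : (Fin 8 → ℝ) →ᵃ[ℝ] ℝ where
  toFun x := 1 + ∑ c, (grad k j c : ℝ) / 24 * (x c - vtx k j c)
  linear := ∑ c, ((grad k j c : ℝ) / 24) • LinearMap.proj c
  map_vadd' x v := by
    simp only [vadd_eq_add, LinearMap.sum_apply, LinearMap.smul_apply, LinearMap.proj_apply,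
      smul_eq_mul, Pi.add_apply]
    rw [add_left_comm, ← Finset.sum_add_distrib]
    congr 1
    exact Finset.sum_congr rfl fun c _ => by ring

lemma sum8_eq (f : Fin 8 → ℤ) : sum8 f = ∑ i, f i := by
  rw [Fin.sum_univ_eight]; rfl

lemma baryMap_intVec (k : Fin 64) (j : Fin 9) (y : Fin 8 → ℤ) :
    baryMap k j (intVec y) = bary k j y / 24 := by
  change 1 + ∑ c, (grad k j c : ℝ) / 24 * ((y c : ℝ) - vtx k j c) = _
  rw [bary, sum8_eq]
  push_cast
  rw [add_div, Finset.sum_div]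
  congr 1
  · norm_num
  · exact Finset.sum_congr rfl fun c _ => by ring

lemma baryMap_vtx (k : Fin 64) (i j : Fin 9) :
    baryMap k i (intVec (vtx k j)) = if i = j then 1 else 0 := by
  rw [baryMap_intVec, bary_vtx]
  split_ifs <;> norm_num

/-- The `k`-th representative simplex, in ambient coordinates scaled by `2`. -/
noncomputable def repSimplex (k : Fin 64) : AffineBasis (Fin (8 + 1)) ℝ (Fin 8 → ℝ) :=
  simplexOfCoord (fun j => intVec (vtx k j)) (baryMap k) (baryMap_vtx k)

lemma repSimplex_apply (k : Fin 64) (j : Fin 9) : repSimplex k j = intVec (vtx k j) := rfl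

lemma coord_repSimplex (k : Fin 64) (j : Fin 9) (y : Fin 8 → ℤ) :
    (repSimplex k).coord j (intVec y) = bary k j y / 24 := by
  rw [repSimplex, coord_simplexOfCoord (f := baryMap k), baryMap_intVec]

lemma qval_intForm (a b c d : ℤ) (y : Fin 8 → ℤ) :
    qval (ambientForm a b c d) (intVec y) = intForm a b c d y := by
  rw [qval_ambientForm, intForm, sum8_eq, sum8_eq]
  push_cast
  simp only [intVec, pow_two]

lemma power_repSimplex (a b c d : ℤ) (k : Fin 64) (y : Fin 8 → ℤ) :
    power (ambientForm a b c d) (repSimplex k) (intVec y) = intPower a b c d k y / 24 := by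
  rw [power, interp_apply, qval_intForm]
  simp only [repSimplex_apply, qval_intForm, coord_repSimplex]
  rw [Fin.sum_univ_succ, Fin.sum_univ_eight, intPower]
  push_cast
  ring

/-! ### The system of all simplices -/

/-- The passage from basis coordinates to ambient coordinates scaled by `2`. -/
noncomputable def toAmbient : (Fin 8 → ℝ) ≃ₗ[ℝ] (Fin 8 → ℝ) :=
  Matrix.toLinearEquiv' ((2 : ℝ) • basisE8) (Matrix.invertibleOfIsUnitDet _
    (by rw [Matrix.det_smul, det_basisE8]; norm_num))

lemma toAmbient_apply (u : Fin 8 → ℝ) : toAmbient u = (2 : ℝ) • (basisE8 *ᵥ u) := by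
  rw [← Matrix.smul_mulVec]
  rfl

lemma qval_toAmbient_symm (a b c d : ℝ) (y : Fin 8 → ℝ) :
    qval (invariantForm a b c d) (toAmbient.symm y) = 1 / 4 * qval (ambientForm a b c d) y := by
  obtain ⟨u, rfl⟩ := toAmbient.surjective y
  rw [LinearEquiv.symm_apply_apply, toAmbient_apply, qval_smul, qval_invariantForm]
  ring

/-- The doubled vectors of `E₈`. -/
def IsDoubledE8 (y : Fin 8 → ℤ) : Prop := (∀ c, (2 : ℤ) ∣ y c - y 0) ∧ (4 : ℤ) ∣ ∑ c, y c

lemma IsDoubledE8.exists_toAmbient {y : Fin 8 → ℤ} (h : IsDoubledE8 y) :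
    ∃ v : Fin 8 → ℤ, toAmbient.symm (intVec y) = intVec v := by
  have hmem : WithLp.toLp 2 ((1 / 2 : ℝ) • intVec y) ∈ latticeE8 := by
    rw [mem_latticeE8]
    refine ⟨?_, ?_⟩
    · rcases Int.even_or_odd' (y 0) with ⟨k, hk | hk⟩
      · left
        intro i
        obtain ⟨m, hm⟩ := h.1 i
        refine ⟨m + k, ?_⟩
        have : y i = 2 * (m + k) := by linarith
        simp [intVec, this]
      · right
        intro i
        obtain ⟨m, hm⟩ := h.1 i
        refine ⟨m + k, ?_⟩
        have : y i = 2 * (m + k) + 1 := by linarith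
        simp only [intVec, this, Pi.smul_apply, smul_eq_mul]
        push_cast
        ring
    · obtain ⟨m, hm⟩ := h.2
      refine ⟨m, ?_⟩
      have : ∑ c, (y c : ℝ) = 4 * m := by exact_mod_cast hm
      simp only [intVec, Pi.smul_apply, smul_eq_mul, ← Finset.mul_sum, this]
      ring
  obtain ⟨v, hv⟩ := mem_latticeE8_iff.1 hmem
  refine ⟨v, ?_⟩
  have hv' : basisE8 *ᵥ intVec v = (1 / 2 : ℝ) • intVec y := (WithLp.toLp_injective 2) hv
  rw [LinearEquiv.symm_apply_eq, toAmbient_apply, hv', smul_smul]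
  norm_num

lemma isDoubledE8_vtx (k : Fin 64) (j : Fin 9) : IsDoubledE8 (vtx k j) :=
  ⟨(vtx_mem k j).1, by rw [← sum8_eq]; exact (vtx_mem k j).2⟩

lemma IsDoubledE8.sub {y z : Fin 8 → ℤ} (hy : IsDoubledE8 y) (hz : IsDoubledE8 z) :
    IsDoubledE8 (fun c => y c - z c) := by
  refine ⟨fun c => ?_, ?_⟩
  · change (2 : ℤ) ∣ y c - z c - (y 0 - z 0)
    rw [sub_sub_sub_comm]
    exact dvd_sub (hy.1 c) (hz.1 c)
  · rw [Finset.sum_sub_distrib]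
    exact dvd_sub hy.2 hz.2

lemma IsDoubledE8.signedPerm {y : Fin 8 → ℤ} (hy : IsDoubledE8 y) (σ : Equiv.Perm (Fin 8))
    (ε : ℤ) : IsDoubledE8 (fun c => ε * y (σ c)) := by
  refine ⟨fun c => ?_, ?_⟩
  · change (2 : ℤ) ∣ ε * y (σ c) - ε * y (σ 0)
    rw [← mul_sub, ← sub_sub_sub_cancel_right _ _ (y 0)]
    exact (dvd_sub (hy.1 (σ c)) (hy.1 (σ 0))).mul_left ε
  · rw [← Finset.mul_sum, Equiv.sum_comp σ y]
    exact hy.2.mul_left ε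

/-- A permutation of the coordinates, followed by the multiplication by a sign. -/
noncomputable def signedPerm (σ : Equiv.Perm (Fin 8)) (ε : ℤˣ) :
    (Fin 8 → ℝ) ≃ₗ[ℝ] (Fin 8 → ℝ) where
  toFun y := fun c => ((ε : ℤ) : ℝ) * y (σ c)
  map_add' y z := by funext c; simp [mul_add]
  map_smul' a y := by funext c; simp [mul_left_comm]
  invFun y := fun c => ((ε : ℤ) : ℝ) * y (σ.symm c)
  left_inv y := by
    funext c
    rcases Int.units_eq_one_or ε with rfl | rfl <;> simp
  right_inv y := by
    funext c
    rcases Int.units_eq_one_or ε with rfl | rfl <;> simp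

lemma signedPerm_apply (σ : Equiv.Perm (Fin 8)) (ε : ℤˣ) (y : Fin 8 → ℝ) (c : Fin 8) :
    signedPerm σ ε y c = ((ε : ℤ) : ℝ) * y (σ c) := rfl

lemma signedPerm_intVec (σ : Equiv.Perm (Fin 8)) (ε : ℤˣ) (y : Fin 8 → ℤ) :
    signedPerm σ ε (intVec y) = intVec (fun c => (ε : ℤ) * y (σ c)) := by
  funext c
  simp [signedPerm_apply, intVec]

/-- Permutations act by precomposition, hence the reversed order of the product. -/
lemma signedPerm_signedPerm (σ σ' : Equiv.Perm (Fin 8)) (ε ε' : ℤˣ) (y : Fin 8 → ℝ) :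
    signedPerm σ ε (signedPerm σ' ε' y) = signedPerm (σ' * σ) (ε * ε') y := by
  funext c
  simp [signedPerm_apply, mul_assoc]

lemma qval_signedPerm (a b c d : ℝ) {σ : Equiv.Perm (Fin 8)} (hσ : σ 0 = 0) (ε : ℤˣ)
    (y : Fin 8 → ℝ) :
    qval (ambientForm a b c d) (signedPerm σ ε y) = qval (ambientForm a b c d) y := by
  have h : ((ε : ℤ) : ℝ) ^ 2 = 1 := by
    rcases Int.units_eq_one_or ε with rfl | rfl <;> simp
  simp only [qval_ambientForm, signedPerm_apply, hσ, ← Finset.mul_sum, mul_pow, h, one_mul,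
    Equiv.sum_comp σ y, Equiv.sum_comp σ (fun i => y i ^ 2)]
  linear_combination (b * (y 0 * (∑ i, y i - y 0)) + c * (∑ i, y i - y 0) ^ 2) * h

/-- The labels of the simplices up to translations: a representative and a symmetry. -/
abbrev SimplexClass : Type := Fin 64 × {σ : Equiv.Perm (Fin 8) // σ 0 = 0} × ℤˣ

/-- The symmetry of a class, with values in basis coordinates. -/
noncomputable def classMap (a : SimplexClass) : (Fin 8 → ℝ) ≃ₗ[ℝ] (Fin 8 → ℝ) :=
  (signedPerm a.2.1 a.2.2).trans toAmbient.symm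

lemma classMap_apply (a : SimplexClass) (y : Fin 8 → ℝ) :
    classMap a y = toAmbient.symm (signedPerm a.2.1 a.2.2 y) := rfl

lemma qval_classMap (a b c d : ℝ) (s : SimplexClass) (y : Fin 8 → ℝ) :
    qval (invariantForm a b c d) (classMap s y) = 1 / 4 * qval (ambientForm a b c d) y := by
  rw [classMap_apply, qval_toAmbient_symm, qval_signedPerm _ _ _ _ s.2.1.2]

lemma IsDoubledE8.exists_classMap {y : Fin 8 → ℤ} (h : IsDoubledE8 y) (s : SimplexClass) :
    ∃ v : Fin 8 → ℤ, classMap s (intVec y) = intVec v := by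
  rw [classMap_apply, signedPerm_intVec]
  exact (h.signedPerm _ _).exists_toAmbient

/-- The simplices of the triangulation. -/
noncomputable def simplex (S : SimplexClass × (Fin 8 → ℤ)) :
    AffineBasis (Fin (8 + 1)) ℝ (Fin 8 → ℝ) :=
  movedSimplex (repSimplex S.1.1) (intVec S.2) (classMap S.1)

lemma simplex_apply (S : SimplexClass × (Fin 8 → ℤ)) (j : Fin 9) :
    simplex S j = intVec S.2 + classMap S.1 (intVec (vtx S.1.1 j)) := rfl

lemma exists_simplex_eq_intVec (S : SimplexClass × (Fin 8 → ℤ)) (j : Fin 9) :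
    ∃ v, simplex S j = intVec v := by
  obtain ⟨v, hv⟩ := (isDoubledE8_vtx S.1.1 j).exists_classMap S.1
  exact ⟨S.2 + v, by rw [simplex_apply, hv, intVec_add]⟩

lemma coord_simplex (S : SimplexClass × (Fin 8 → ℤ)) (j : Fin 9) (y : Fin 8 → ℤ) :
    (simplex S).coord j (intVec S.2 + classMap S.1 (intVec y)) = bary S.1.1 j y / 24 := by
  rw [simplex, coord_movedSimplex, coord_repSimplex]

/-- The denominator is `96 = 4 * 24`, from the doubled coordinates and the denominator of the
barycentric coordinates. Signs of powers thus depend on the representative only. -/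
lemma power_simplex (a b c d : ℤ) (S : SimplexClass × (Fin 8 → ℤ)) (y : Fin 8 → ℤ) :
    power (invariantForm a b c d) (simplex S) (intVec S.2 + classMap S.1 (intVec y)) =
      intPower a b c d S.1.1 y / 96 := by
  rw [simplex, power_movedSimplex _ _ _ (qval_classMap a b c d S.1), power_repSimplex]
  ring

/-- The approximate circumcentres of the simplices. -/
noncomputable def simplexCenter (S : SimplexClass × (Fin 8 → ℤ)) : Fin 8 → ℝ :=
  intVec S.2 + classMap S.1 ((1 / 10 ^ 6 : ℝ) • intVec (center S.1.1))

lemma qval_simplex_sub_simplexCenter (a b c d : ℤ) (S : SimplexClass × (Fin 8 → ℤ)) (j : Fin 9) :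
    qval (invariantForm a b c d) (simplex S j - simplexCenter S) =
      intForm a b c d (fun c => 10 ^ 6 * vtx S.1.1 j c - center S.1.1 c) / (4 * 10 ^ 12) := by
  have h : intVec (vtx S.1.1 j) - (1 / 10 ^ 6 : ℝ) • intVec (center S.1.1) =
      (1 / 10 ^ 6 : ℝ) • intVec (fun c => 10 ^ 6 * vtx S.1.1 j c - center S.1.1 c) := by
    funext c
    simp only [intVec, Pi.sub_apply, Pi.smul_apply, smul_eq_mul]
    push_cast
    ring
  rw [simplex_apply, simplexCenter, add_sub_add_left_eq_sub, ← map_sub, qval_classMap, h,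
    qval_smul, qval_intForm]
  ring

/-- The neighbour of a representative is a signed permutation and translate of another one.
Composing with the symmetry and translation of `S` gives the label of the neighbour of `S`; the
added translation `w` is integral because `nbrShift` is a doubled vector of `E₈`. -/
lemma exists_neighbor (S : SimplexClass × (Fin 8 → ℤ)) (i : Fin 9) :
    ∃ S', (∀ j, j ≠ i → ∃ j', simplex S' j' = simplex S j) ∧
      ∃ j', simplex S' j' = intVec S.2 + classMap S.1 (intVec (newVtx S.1.1 i)) := by
  obtain ⟨⟨k, ⟨σ, hσ⟩, ε⟩, t⟩ := S
  obtain ⟨hp0, hp⟩ := nbrPerm_spec k i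
  let τ : Equiv.Perm (Fin 8) :=
    Equiv.ofBijective (nbrPerm k i) (Finite.injective_iff_bijective.1 fun c c' h => hp c c' h)
  obtain ⟨η, hη⟩ : ∃ η : ℤˣ, (η : ℤ) = nbrSign k i := by
    rcases nbrSign_eq k i with h | h
    · exact ⟨1, by rw [h]; rfl⟩
    · exact ⟨-1, by rw [h]; rfl⟩
  have himage : ∀ j, IsDoubledE8 (nbrImage k i j) := fun j =>
    (isDoubledE8_vtx (nbr k i) (nbrVtx k i j)).signedPerm τ (nbrSign k i)
  have hshift : IsDoubledE8 (nbrShift k i) := by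
    by_cases hi : i = 0
    · have := (isDoubledE8_vtx k 1).sub (himage 1)
      convert this using 2
      simp [nbrShift, hi]
    · have := (isDoubledE8_vtx k 0).sub (himage 0)
      convert this using 2
      simp [nbrShift, hi]
  obtain ⟨w, hw⟩ := hshift.exists_classMap (k, ⟨σ, hσ⟩, ε)
  have hτ : τ 0 = 0 := hp0
  have key : ∀ j, simplex ((nbr k i, ⟨τ * σ, by simp [hσ, hτ]⟩, ε * η), t + w) (nbrVtx k i j) =
      intVec t + classMap (k, ⟨σ, hσ⟩, ε)
        (intVec (fun c => nbrImage k i j c + nbrShift k i c)) := by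
    intro j
    have h1 : intVec (fun c => nbrImage k i j c + nbrShift k i c) =
        signedPerm τ η (intVec (vtx (nbr k i) (nbrVtx k i j))) + intVec (nbrShift k i) := by
      rw [signedPerm_intVec, hη, ← intVec_add]
      rfl
    rw [h1, map_add, hw, simplex_apply, classMap_apply, classMap_apply, signedPerm_signedPerm,
      intVec_add]
    abel
  refine ⟨_, fun j hj => ⟨nbrVtx k i j, (key j).trans ?_⟩, nbrVtx k i i, key i⟩
  rw [simplex_apply]
  congr 3
  funext c
  exact nbrImage_add_nbrShift k i j hj c

lemma posDef_invariantForm_20 : (invariantForm 20 1 (-1) 25).PosDef :=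
  posDef_invariantForm (by norm_num) (by norm_num) (by norm_num)

/-- The simplices form a Delone system. -/
theorem isDeloneSystem_simplex : IsDeloneSystem simplex (invariantForm 20 1 (-1) 25) where
  nonempty := ⟨⟨⟨0, ⟨1, rfl⟩, 1⟩, 0⟩⟩
  posDef := posDef_invariantForm_20
  integral := exists_simplex_eq_intVec
  isVertex S v hv := by
    -- A lattice point in the simplex has a vertex at squared `E₈`-distance below `2`; as `E₈` is
    -- even, that distance is `0`. The numerator `8 * 10 ^ 12 - 1` makes the strict integer bound a
    -- weak one that still stays below `2`.
    obtain ⟨j, hj⟩ := exists_qval_sub_le_of_coord_nonneg (simplex S) posDef_formE8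
      (M := (8 * 10 ^ 12 - 1) / (4 * 10 ^ 12)) (simplexCenter S) (fun j => by
        have h := qval_simplex_sub_simplexCenter 1 0 0 1 S j
        have h2 : intForm 1 0 0 1 (fun c => 10 ^ 6 * vtx S.1.1 j c - center S.1.1 c) ≤
            8 * 10 ^ 12 - 1 := Int.le_sub_one_of_lt (intForm_center S.1.1 j).2
        rw [formE8_eq]
        push_cast at h
        rw [h]
        refine div_le_div_of_nonneg_right ?_ (by positivity)
        exact_mod_cast h2) hv
    obtain ⟨w, hw⟩ := exists_simplex_eq_intVec S j
    refine ⟨j, ?_⟩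
    rw [hw] at hj ⊢
    rw [sub_eq_add_neg, ← intVec_neg, ← intVec_add] at hj
    obtain ⟨m, hm⟩ := exists_qval_formE8 (w + -v)
    by_contra hne
    have hpos : 0 < qval formE8 (intVec (w + -v)) := by
      refine qval_pos posDef_formE8 fun h0 => hne ?_
      rw [intVec_add, intVec_neg] at h0
      exact add_neg_eq_zero.1 h0
    rw [hm] at hj hpos
    have h1 : (0 : ℝ) < m := by linarith
    have h2 : (0 : ℤ) < m := by exact_mod_cast h1
    have h3 : (1 : ℝ) ≤ m := by exact_mod_cast h2
    norm_num at hj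
    linarith
  finite x T := by
    have hfin : ∀ a : SimplexClass, {t : Fin 8 → ℤ |
        power (invariantForm 20 1 (-1) 25) (simplex (a, t)) x ≤ T}.Finite := by
      intro a
      obtain ⟨c, r, h⟩ := exists_circumcenter (simplex (a, 0)) posDef_invariantForm_20
      refine (finite_qval_sub_le posDef_invariantForm_20 (x - c) (T + r ^ 2)).subset ?_
      intro t ht
      -- Translating the simplex by `t` amounts to translating the point by `-t`, so `t` ranges over
      -- the lattice points of one ellipsoid; there are finitely many classes.
      have e : power (invariantForm 20 1 (-1) 25) (simplex (a, t)) x =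
          power (invariantForm 20 1 (-1) 25) (simplex (a, 0)) (x - intVec t) := by
        obtain ⟨y, hy⟩ := (classMap a).surjective (x - intVec t)
        have h0 : intVec (0 : Fin 8 → ℤ) = 0 := by funext i; simp [intVec]
        have h1 := power_movedSimplex (repSimplex a.1) (intVec t) (classMap a)
          (qval_classMap 20 1 (-1) 25 a) y
        have h2 := power_movedSimplex (repSimplex a.1) (intVec 0) (classMap a)
          (qval_classMap 20 1 (-1) 25 a) y
        rw [hy, add_sub_cancel] at h1
        rw [hy, h0, zero_add, ← h0] at h2
        exact h1.trans h2.symm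
      simp only [Set.mem_ofPred_eq] at ht ⊢
      rw [e, h] at ht
      rw [qval_sub_comm]
      have : x - c - intVec t = x - intVec t - c := by abel
      rw [this]
      linarith
    refine (Set.finite_iUnion fun a => (hfin a).image (Prod.mk a)).subset ?_
    rintro ⟨a, t⟩ h
    exact Set.mem_iUnion.2 ⟨a, t, h, rfl⟩
  neighbor S i := by
    obtain ⟨S', h, j', hj'⟩ := exists_neighbor S i
    obtain ⟨h1, h2, -, -⟩ := newVtx_spec S.1.1 i
    refine ⟨S', h, j', ?_, ?_⟩
    · rw [hj', coord_simplex]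
      have : (bary S.1.1 i (newVtx S.1.1 i) : ℝ) < 0 := by exact_mod_cast h1
      linarith
    · have := power_simplex 20 1 (-1) 25 S (newVtx S.1.1 i)
      push_cast at this
      rw [hj', this]
      have : (0 : ℝ) < intPower 20 1 (-1) 25 S.1.1 (newVtx S.1.1 i) := by exact_mod_cast h2
      positivity

/-! ### Convexity of the two forms on the system, and the covering bound for `Q̃` -/

lemma isConvexOn_invariantForm {a b c d : ℤ}
    (h : ∀ k i, 0 ≤ intPower a b c d k (newVtx k i)) :
    IsConvexOn simplex (invariantForm a b c d) (invariantForm 20 1 (-1) 25) := by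
  intro S i
  obtain ⟨S', hf, j', hj'⟩ := exists_neighbor S i
  obtain ⟨h1, h2, -, -⟩ := newVtx_spec S.1.1 i
  refine ⟨S', hf, j', ?_, ?_, ?_⟩
  · rw [hj', coord_simplex]
    have : (bary S.1.1 i (newVtx S.1.1 i) : ℝ) < 0 := by exact_mod_cast h1
    linarith
  · have := power_simplex 20 1 (-1) 25 S (newVtx S.1.1 i)
    push_cast at this
    rw [hj', this]
    have : (0 : ℝ) < intPower 20 1 (-1) 25 S.1.1 (newVtx S.1.1 i) := by exact_mod_cast h2
    positivity
  · rw [hj', power_simplex]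
    have : (0 : ℝ) ≤ intPower a b c d S.1.1 (newVtx S.1.1 i) := by exact_mod_cast h S.1.1 i
    positivity

lemma isConvexOn_formE8 : IsConvexOn simplex formE8 (invariantForm 20 1 (-1) 25) := by
  have := isConvexOn_invariantForm (a := 1) (b := 0) (c := 0) (d := 1)
    fun k i => (newVtx_spec k i).2.2.1
  rw [formE8_eq]
  push_cast at this
  exact this

lemma smul_invariantForm (s a b c d : ℝ) :
    s • invariantForm a b c d = invariantForm (s * a) (s * b) (s * c) (s * d) := by
  have : s • ambientForm a b c d = ambientForm (s * a) (s * b) (s * c) (s * d) := by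
    ext i j
    simp only [ambientForm, Matrix.smul_apply, Matrix.of_apply, smul_eq_mul]
    split_ifs <;> ring
  rw [invariantForm, invariantForm, ← this, Matrix.mul_smul, Matrix.smul_mul]

/-- The integral multiple of `Q̃`. -/
lemma smul_formTilde : (84 : ℝ) • formTilde = invariantForm (718812985149 : ℤ)
    (-600705210 : ℤ) (-34429424839 : ℤ) (958016843392 : ℤ) := by
  rw [formTilde_eq, smul_invariantForm]
  push_cast
  norm_num

lemma qval_smul_form {d : ℕ} (s : ℝ) (Q : Matrix (Fin d) (Fin d) ℝ) (x : Fin d → ℝ) :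
    qval (s • Q) x = s * qval Q x := by
  simp [qval, Matrix.smul_mulVec]

/-- The finite check concerns the integral form `84 Q̃`; powers scale linearly with the form. -/
lemma isConvexOn_formTilde : IsConvexOn simplex formTilde (invariantForm 20 1 (-1) 25) := by
  intro S i
  obtain ⟨S', hf, j', h1, h2, h3⟩ := isConvexOn_invariantForm
    (fun k i => (newVtx_spec k i).2.2.2) S i
  refine ⟨S', hf, j', h1, h2, ?_⟩
  rw [← smul_formTilde] at h3
  simp only [power, interp_apply, qval_smul_form] at h3 ⊢
  have : ∀ j, (simplex S).coord j (simplex S' j') * (84 * qval formTilde (simplex S j)) =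
      84 * ((simplex S).coord j (simplex S' j') * qval formTilde (simplex S j)) :=
    fun j => by ring
  simp only [this, ← Finset.mul_sum] at h3
  linarith

/-- An upper bound for the squared covering radius of `Q̃`. -/
lemma exists_qval_formTilde_le (x : Fin 8 → ℝ) :
    ∃ v : Fin 8 → ℤ, qval formTilde (x - intVec v) ≤ 10000010000 := by
  refine isDeloneSystem_simplex.exists_qval_sub_le posDef_formTilde simplexCenter
    (fun S j => ?_) x
  have h := qval_simplex_sub_simplexCenter 718812985149 (-600705210) (-34429424839)
    958016843392 S j
  rw [← smul_formTilde, qval_smul_form] at h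
  have h2 : (intForm 718812985149 (-600705210) (-34429424839) 958016843392
      (fun c => 10 ^ 6 * vtx S.1.1 j c - center S.1.1 c) : ℝ) ≤
      336 * 10000010000 * 10 ^ 12 := by
    exact_mod_cast (intForm_center S.1.1 j).1
  have h3 := div_le_div_of_nonneg_right h2 (by positivity : (0 : ℝ) ≤ 4 * 10 ^ 12)
  rw [← h] at h3
  norm_num at h3
  linarith

/-! ### Covolume and covering radius of a lattice given by a matrix -/

section Lattice

variable {d : ℕ} (A : Matrix (Fin d) (Fin d) ℝ) (hA : A.det ≠ 0)

/-- The columns of a regular matrix as a basis of Euclidean space. -/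
noncomputable def columnBasis : Module.Basis (Fin d) ℝ (Euc d) :=
  (EuclideanSpace.basisFun (Fin d) ℝ).toBasis.map
    (((WithLp.linearEquiv 2 ℝ (Fin d → ℝ)).trans
      (A.toLinearEquiv' (Matrix.invertibleOfIsUnitDet _ hA.isUnit))).trans
      (WithLp.linearEquiv 2 ℝ (Fin d → ℝ)).symm)

lemma columnBasis_apply (j i : Fin d) : columnBasis A hA j i = A i j := by
  have : columnBasis A hA j = WithLp.toLp 2 (A *ᵥ Pi.single j 1) := by
    rw [columnBasis, Module.Basis.map_apply, OrthonormalBasis.coe_toBasis,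
      EuclideanSpace.basisFun_apply]
    rfl
  rw [this]
  simp

/-- The lattice `A ℤ^d`. -/
noncomputable def columnLattice : Submodule ℤ (Euc d) :=
  Submodule.span ℤ (Set.range (columnBasis A hA))

instance : DiscreteTopology (columnLattice A hA) :=
  inferInstanceAs (DiscreteTopology (Submodule.span ℤ (Set.range (columnBasis A hA))))

instance : IsZLattice ℝ (columnLattice A hA) :=
  inferInstanceAs (IsZLattice ℝ (Submodule.span ℤ (Set.range (columnBasis A hA))))

lemma mem_columnLattice {x : Euc d} :
    x ∈ columnLattice A hA ↔ ∃ v : Fin d → ℤ, WithLp.toLp 2 (A *ᵥ intVec v) = x := by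
  rw [columnLattice, Submodule.mem_span_range_iff_exists_fun]
  refine exists_congr fun v => ?_
  have : ∑ i, v i • columnBasis A hA i = WithLp.toLp 2 (A *ᵥ intVec v) := by
    ext i
    simp [columnBasis_apply, Matrix.mulVec, dotProduct, intVec, mul_comm]
  rw [this]

lemma covolume_columnLattice : ZLattice.covolume (columnLattice A hA) = |A.det| := by
  rw [ZLattice.covolume_eq_measure_fundamentalDomain (columnLattice A hA)
    MeasureTheory.volume (F := ZSpan.fundamentalDomain (columnBasis A hA))
    (ZSpan.isAddFundamentalDomain (columnBasis A hA) MeasureTheory.volume),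
    ZSpan.measureReal_fundamentalDomain _ _ (EuclideanSpace.basisFun (Fin d) ℝ).toBasis,
    MeasureTheory.measureReal_congr (ZSpan.fundamentalDomain_ae_parallelepiped _ _)]
  have h1 : MeasureTheory.volume.real
      (parallelepiped (EuclideanSpace.basisFun (Fin d) ℝ).toBasis) = 1 := by
    rw [MeasureTheory.measureReal_def, OrthonormalBasis.coe_toBasis,
      OrthonormalBasis.volume_parallelepiped]
    rfl
  rw [h1, mul_one, Module.Basis.det_apply]
  congr 2
  ext i j
  rw [Module.Basis.toMatrix_apply]
  simp [columnBasis_apply]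

lemma isAssociated_columnLattice : IsAssociated (Aᵀ * A) (columnLattice A hA) := by
  refine ⟨A, hA, ?_, rfl⟩
  ext x
  exact mem_columnLattice A hA

/-- The covering radius is bounded by the distances to the nearest lattice points. -/
lemma coveringRadius_columnLattice_le {r : ℝ} (hr : 0 < r)
    (h : ∀ x : Fin d → ℝ, ∃ v : Fin d → ℤ, qval (Aᵀ * A) (x - intVec v) ≤ r ^ 2) :
    coveringRadius (columnLattice A hA) ≤ r := by
  refine csInf_le ⟨0, fun s hs => hs.1.le⟩ ⟨hr, fun y => ?_⟩
  obtain ⟨x, hx⟩ : ∃ x : Fin d → ℝ, A *ᵥ x = WithLp.ofLp y :=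
    ⟨A⁻¹ *ᵥ WithLp.ofLp y, by
      rw [Matrix.mulVec_mulVec, Matrix.mul_nonsing_inv _ hA.isUnit, Matrix.one_mulVec]⟩
  obtain ⟨v, hv⟩ := h x
  refine ⟨WithLp.toLp 2 (A *ᵥ intVec v), (mem_columnLattice A hA).2 ⟨v, rfl⟩, ?_⟩
  rw [Metric.mem_closedBall, dist_eq_norm]
  refine abs_le_of_sq_le_sq' ?_ hr.le |>.2
  have : y - WithLp.toLp 2 (A *ᵥ intVec v) = WithLp.toLp 2 (A *ᵥ (x - intVec v)) := by
    rw [Matrix.mulVec_sub, hx]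
    rfl
  rw [this, EuclideanSpace.norm_sq_eq]
  refine le_trans (le_of_eq ?_) hv
  rw [qval, ← Matrix.mulVec_mulVec, Matrix.dotProduct_mulVec _ Aᵀ, Matrix.vecMul_transpose]
  simp [dotProduct, pow_two]

end Lattice

lemma unitBallVolume_eight : unitBallVolume 8 = Real.pi ^ 4 / 24 := by
  rw [unitBallVolume, EuclideanSpace.volume_closedBall]
  have hG : Real.Gamma ((Fintype.card (Fin 8) : ℝ) / 2 + 1) = 24 := by
    have : ((Fintype.card (Fin 8) : ℝ) / 2 + 1) = ((4 : ℕ) : ℝ) + 1 := by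
      rw [Fintype.card_fin]; norm_num
    rw [this, Real.Gamma_nat_eq_factorial]
    norm_num [Nat.factorial]
  have hpi : (√Real.pi) ^ Fintype.card (Fin 8) = Real.pi ^ 4 := by
    rw [Fintype.card_fin, show 8 = 2 * 4 from rfl, pow_mul, Real.sq_sqrt Real.pi_pos.le]
  rw [hG, hpi, ENNReal.ofReal_one, one_pow, one_mul, ENNReal.toReal_ofReal (by positivity)]

/-! ### A lattice with form `Q̃` -/

/-- The unipotent factor in the triangular decomposition of `α Q₁ - β Q₂`. -/
noncomputable def unipotentFactor (α β : ℝ) : Matrix (Fin 8) (Fin 8) ℝ :=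
  !![1, 0, 0, 0, 0, 0, 0, 0;
     -(63 * β) / (α + 35 * β), 1, 0, 0, 0, 0, 0, 0;
     0, -5 / 6, 1, 0, 0, 0, 0, 0;
     0, 0, -4 / 5, 1, 0, 0, 0, 0;
     0, 0, 0, -3 / 4, 1, 0, 0, 0;
     0, 0, 0, 0, -2 / 3, 1, 0, 0;
     0, 0, 0, 0, 0, -1 / 2, 1, 0;
     1 / 2, 0, 0, 0, 0, 0, 0, 1]

/-- The diagonal factor in the triangular decomposition of `α Q₁ - β Q₂`. -/
noncomputable def diagonalFactor (α β : ℝ) : Fin 8 → ℝ :=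
  ![7 * β * (α - β) / (4 * (α + 35 * β)), (α + 35 * β) / 63, 4 / 5 * (α - β), 5 / 6 * (α - β),
    8 / 9 * (α - β), α - β, 4 / 3 * (α - β), 4 * α - 7 * β]

/-- Successive completion of squares. Taking roots of the diagonal factor yields an explicit `A`
with `Q̃ = Aᵗ A` and its determinant. -/
lemma triangular_decomposition {α β : ℝ} (h : α + 35 * β ≠ 0) :
    (unipotentFactor α β)ᵀ * (Matrix.diagonal (diagonalFactor α β) * unipotentFactor α β) =
      α • form1 - β • form2 := by
  -- The only non-numerical denominator becomes the single variable `p`.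
  obtain ⟨p, rfl⟩ : ∃ p, α = p - 35 * β := ⟨α + 35 * β, by ring⟩
  rw [sub_add_cancel] at h
  ext i j
  rw [Matrix.mul_apply, Fin.sum_univ_eight, Matrix.sub_apply, Matrix.smul_apply,
    Matrix.smul_apply]
  simp only [Matrix.diagonal_mul, Matrix.transpose_apply]
  fin_cases i <;> fin_cases j <;>
    simp [unipotentFactor, diagonalFactor, form1, form2, sub_add_cancel] <;> field_simp <;> ring

lemma det_unipotentFactor (α β : ℝ) : (unipotentFactor α β).det = 1 := by
  rw [Matrix.det_of_isLowerTriangular]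
  · simp [unipotentFactor, Fin.prod_univ_succ]
  · intro i j hij
    fin_cases i <;> fin_cases j <;> first | rfl | (exfalso; revert hij; decide)

/-- A regular matrix `A` with `Q̃ = Aᵗ A`. -/
noncomputable def matrixTilde : Matrix (Fin 8) (Fin 8) ℝ :=
  Matrix.diagonal (fun i => √(diagonalFactor 34229189769 17121746137 i)) *
    unipotentFactor 34229189769 17121746137

lemma diagonalFactor_pos (i : Fin 8) : 0 < diagonalFactor 34229189769 17121746137 i := by
  fin_cases i <;> simp [diagonalFactor] <;> norm_num

lemma matrixTilde_transpose_mul : matrixTildeᵀ * matrixTilde = formTilde := by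
  rw [formTilde, ← triangular_decomposition (by norm_num), matrixTilde, Matrix.transpose_mul,
    Matrix.diagonal_transpose, Matrix.mul_assoc, ← Matrix.mul_assoc (Matrix.diagonal _),
    Matrix.diagonal_mul_diagonal]
  congr 3
  funext i
  exact Real.mul_self_sqrt (diagonalFactor_pos i).le

lemma det_matrixTilde_pos : 0 < matrixTilde.det := by
  rw [matrixTilde, Matrix.det_mul, Matrix.det_diagonal, det_unipotentFactor, mul_one]
  exact Finset.prod_pos fun i _ => Real.sqrt_pos.2 (diagonalFactor_pos i)

/-- The factors `α + 35 β` cancel in the product of the diagonal, leaving `16 / 729 * β (α - β) ^ 6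
(4 α - 7 β)`. -/
lemma det_matrixTilde_sq : matrixTilde.det ^ 2 =
    17121746137 * 17107443632 ^ 6 * 17064536117 * 16 / 729 := by
  rw [matrixTilde, Matrix.det_mul, Matrix.det_diagonal, det_unipotentFactor, mul_one,
    ← Finset.prod_pow, Finset.prod_congr rfl fun i _ => Real.sq_sqrt (diagonalFactor_pos i).le]
  simp only [Fin.prod_univ_eight, diagonalFactor, Matrix.cons_val]
  norm_num

/-- The lattice with form `Q̃`. -/
noncomputable def latticeTilde : Submodule ℤ (Euc 8) :=
  columnLattice matrixTilde det_matrixTilde_pos.ne'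

instance : DiscreteTopology latticeTilde :=
  inferInstanceAs (DiscreteTopology (columnLattice matrixTilde det_matrixTilde_pos.ne'))

instance : IsZLattice ℝ latticeTilde :=
  inferInstanceAs (IsZLattice ℝ (columnLattice matrixTilde det_matrixTilde_pos.ne'))

lemma isAssociated_formTilde : IsAssociated formTilde latticeTilde := by
  rw [← matrixTilde_transpose_mul]
  exact isAssociated_columnLattice _ _

lemma coveringRadius_latticeTilde_le : coveringRadius latticeTilde ≤ √10000010000 := by
  refine coveringRadius_columnLattice_le _ _ (by positivity) fun x => ?_
  rw [Real.sq_sqrt (by norm_num), matrixTilde_transpose_mul]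
  exact exists_qval_formTilde_le x

lemma coveringDensity_latticeTilde_lt : coveringDensity latticeTilde < 3.2013 := by
  have hD := det_matrixTilde_pos
  -- A decimal lower bound for the root of `det_matrixTilde_sq`, precise enough to leave room for
  -- the bounds on the radius and on `π`.
  have hD2 : (1.26786 * 10 ^ 40 : ℝ) ≤ matrixTilde.det := by
    refine le_of_sq_le_sq ?_ hD.le
    rw [det_matrixTilde_sq]
    norm_num
  have h0 : 0 ≤ coveringRadius latticeTilde := Real.sInf_nonneg fun r hr => hr.1.le
  have hr : coveringRadius latticeTilde ^ 8 ≤ 10000010000 ^ 4 := by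
    calc _ ≤ (√10000010000) ^ 8 := pow_le_pow_left₀ h0 coveringRadius_latticeTilde_le 8
      _ = ((√10000010000) ^ 2) ^ 4 := by ring
      _ = _ := by rw [Real.sq_sqrt (by norm_num)]
  have hpi : Real.pi ^ 4 ≤ 3.1416 ^ 4 :=
    pow_le_pow_left₀ Real.pi_pos.le Real.pi_lt_d4.le 4
  rw [coveringDensity, latticeTilde, covolume_columnLattice, abs_of_pos hD, div_lt_iff₀ hD,
    unitBallVolume_eight]
  change coveringRadius latticeTilde ^ 8 * _ < _
  calc _ ≤ (10000010000 ^ 4 : ℝ) * (3.1416 ^ 4 / 24) := by gcongr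
    _ < 3.2013 * (1.26786 * 10 ^ 40) := by norm_num
    _ ≤ _ := by gcongr

/-! ### Symmetry -/

lemma basisE8_mulVec_permE8 (σ : Equiv.Perm (Fin 8)) (x : Fin 8 → ℝ) :
    basisE8 *ᵥ (permE8 σ *ᵥ x) = fun i => (basisE8 *ᵥ x) (σ i) := by
  have hu : IsUnit basisE8.det := by rw [det_basisE8]; exact isUnit_one
  rw [permE8, Matrix.mulVec_mulVec, Matrix.mul_assoc, Matrix.mul_nonsing_inv_cancel_left _ _ hu,
    ← Matrix.mulVec_mulVec, Matrix.permMatrix_mulVec]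
  rfl

lemma basisE8_mulVec_injective : Function.Injective (basisE8 *ᵥ ·) := by
  intro x y h
  by_contra hne
  refine basisE8_mulVec_ne_zero (sub_ne_zero.2 hne) ?_
  rw [Matrix.mulVec_sub]
  exact sub_eq_zero.2 h

/-- The conditions defining `E₈` are symmetric in the coordinates, so a coordinate permutation maps
the lattice to itself and is integral in basis coordinates. -/
lemma permE8_mulVec_intVec (σ : Equiv.Perm (Fin 8)) (v : Fin 8 → ℤ) :
    ∃ w : Fin 8 → ℤ, permE8 σ *ᵥ intVec v = intVec w := by
  obtain ⟨h1, m, hm⟩ := mem_latticeE8.1 (mem_latticeE8_iff.2 ⟨v, rfl⟩)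
  have hmem : WithLp.toLp 2 (fun i => (basisE8 *ᵥ intVec v) (σ i)) ∈ latticeE8 := by
    refine mem_latticeE8.2 ⟨h1.imp (fun h i => h (σ i)) (fun h i => h (σ i)), m, ?_⟩
    rw [← hm]
    exact Equiv.sum_comp σ (basisE8 *ᵥ intVec v)
  obtain ⟨w, hw⟩ := mem_latticeE8_iff.1 hmem
  refine ⟨w, basisE8_mulVec_injective ?_⟩
  change basisE8 *ᵥ _ = basisE8 *ᵥ _
  rw [basisE8_mulVec_permE8]
  exact ((WithLp.toLp_injective 2) hw).symm

lemma permE8_mulVec_permE8_symm (σ : Equiv.Perm (Fin 8)) (x : Fin 8 → ℝ) :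
    permE8 σ *ᵥ (permE8 σ.symm *ᵥ x) = x := by
  refine basisE8_mulVec_injective ?_
  change basisE8 *ᵥ _ = basisE8 *ᵥ _
  rw [basisE8_mulVec_permE8, basisE8_mulVec_permE8]
  simp

lemma qval_permE8 (a b c d : ℝ) {σ : Equiv.Perm (Fin 8)} (hσ : σ 0 = 0) (x : Fin 8 → ℝ) :
    qval (invariantForm a b c d) (permE8 σ *ᵥ x) = qval (invariantForm a b c d) x := by
  rw [qval_invariantForm, qval_invariantForm, basisE8_mulVec_permE8, qval_ambientForm,
    qval_ambientForm, Equiv.sum_comp σ, Equiv.sum_comp σ (fun i => (basisE8 *ᵥ x) i ^ 2), hσ]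

/-- The Delone subdivision is invariant under the integral linear isometries of the form. -/
lemma image_mem_deloneSubdivision {d : ℕ} {Q : Matrix (Fin d) (Fin d) ℝ}
    (g : (Fin d → ℝ) ≃ₗ[ℝ] (Fin d → ℝ)) (hQ : ∀ x, qval Q (g x) = qval Q x)
    (hg : ∀ v : Fin d → ℤ, ∃ w : Fin d → ℤ, g (intVec v) = intVec w)
    (hg' : ∀ v : Fin d → ℤ, ∃ w : Fin d → ℤ, g.symm (intVec v) = intVec w)
    {P : Set (Fin d → ℝ)} (hP : P ∈ deloneSubdivision Q) : g '' P ∈ deloneSubdivision Q := by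
  classical
  obtain ⟨V, hV, rfl, c, r, h1, h2⟩ := hP
  choose f hf using hg
  choose f' hf' using hg'
  have hff' : ∀ v, f (f' v) = v := fun v => intVec_injective (by rw [← hf, ← hf']; simp)
  refine ⟨V.image f, hV.image f, ?_, g c, r, ?_, ?_⟩
  · rw [← LinearEquiv.coe_coe, LinearMap.image_convexHull, Finset.coe_image, Set.image_image,
      Set.image_image]
    simp only [LinearEquiv.coe_coe, hf]
  · intro v hv
    obtain ⟨w, hw, rfl⟩ := Finset.mem_image.1 hv
    rw [← hf, ← map_sub, hQ]
    exact h1 w hw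
  · intro v hv
    have hw : f' v ∉ V := fun hw => hv (Finset.mem_image.2 ⟨_, hw, hff' v⟩)
    have := h2 _ hw
    rwa [← hQ, map_sub, hf, hff'] at this

/-- The symmetry is inherited from the form alone and needs nothing about the triangulation. -/
lemma isSymmetric_invariantForm (a b c d : ℝ) :
    IsSymmetric (deloneSubdivision (invariantForm a b c d)) := by
  constructor
  · intro σ hσ P hP
    let g : (Fin 8 → ℝ) ≃ₗ[ℝ] (Fin 8 → ℝ) := LinearEquiv.ofLinearMap
      (Matrix.toLin' (permE8 σ)) (Matrix.toLin' (permE8 σ.symm))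
      (LinearMap.ext fun x => permE8_mulVec_permE8_symm σ x)
      (LinearMap.ext fun x => permE8_mulVec_permE8_symm σ.symm x)
    exact image_mem_deloneSubdivision g (qval_permE8 a b c d hσ) (permE8_mulVec_intVec σ)
      (permE8_mulVec_intVec σ.symm) hP
  · intro P hP
    exact image_mem_deloneSubdivision (LinearEquiv.neg ℝ) (fun x => qval_neg _ x)
      (fun v => ⟨-v, (intVec_neg v).symm⟩) (fun v => ⟨-v, (intVec_neg v).symm⟩) hP

end LatticeCovering

/-! ### The theorem -/

theorem theorem2 :
    ∃ (L : Submodule ℤ (LatticeCovering.Euc 8)) (_ : DiscreteTopology L) (_ : IsZLattice ℝ L),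
      LatticeCovering.coveringDensity L < 3.2013 ∧
      LatticeCovering.HaveCommonDeloneRefinement L LatticeCovering.latticeE8 ∧
      LatticeCovering.IsAssociated LatticeCovering.formTilde L ∧
      LatticeCovering.IsAssociated LatticeCovering.formE8 LatticeCovering.latticeE8 ∧
      ∃ R : Matrix (Fin 8) (Fin 8) ℝ, R.PosDef ∧
        LatticeCovering.IsSimplicial (LatticeCovering.deloneSubdivision R) ∧
        LatticeCovering.IsSymmetric (LatticeCovering.deloneSubdivision R) ∧
        LatticeCovering.IsRefinement (LatticeCovering.deloneSubdivision R)
          (LatticeCovering.deloneSubdivision LatticeCovering.formTilde) ∧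
        LatticeCovering.IsRefinement (LatticeCovering.deloneSubdivision R)
          (LatticeCovering.deloneSubdivision LatticeCovering.formE8) := by
  have hT := LatticeCovering.isDeloneSystem_simplex.isRefinement
    LatticeCovering.posDef_formTilde LatticeCovering.isConvexOn_formTilde
  have hE := LatticeCovering.isDeloneSystem_simplex.isRefinement
    LatticeCovering.posDef_formE8 LatticeCovering.isConvexOn_formE8
  exact ⟨LatticeCovering.latticeTilde, inferInstance, inferInstance,
    LatticeCovering.coveringDensity_latticeTilde_lt,
    ⟨_, _, _, LatticeCovering.isAssociated_formTilde, LatticeCovering.isAssociated_formE8,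
      LatticeCovering.posDef_invariantForm_20, hT, hE⟩,
    LatticeCovering.isAssociated_formTilde, LatticeCovering.isAssociated_formE8, _,
    LatticeCovering.posDef_invariantForm_20, LatticeCovering.isDeloneSystem_simplex.isSimplicial,
    LatticeCovering.isSymmetric_invariantForm _ _ _ _, hT, hE⟩
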